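/- **Setting.** Fix $\alpha\ge 0$ and $\rho\in(0,1)$. Let $d,n\ge 1$, let $\mathcal X\subset\mathbb R^d$ be bounded with radius $r=\sup_{x\in\mathcal X}\|x\|_2$, let $\mathcal Y$ be any set, and let $h:\mathbb R\times\mathcal Y\to\mathbb R$ define the loss $\ell_\theta(x,y)=h(\langle\theta,x\rangle,y)$. Assume that for each $y$ the function $f=h(\cdot,y)$ is convex, twice continuously differentiable and $\varphi$-quasi-self-concordant, i.e. $$f''(t)\,[1-\varphi(|s|)]_+\le f''(t+s)\le f''(t)\,(1+\varphi(|s|))\qquad\text{for all } t,s\in\mathbb R,$$ where $\varphi:[0,\infty)\to[0,\infty]$ is nondecreasing and $\varphi(t)\le\alpha t$ whenever $t \ge 0$ and $\alpha t\le 1-\rho$. Assume $\|\nabla_\theta\ell_\theta(z)\|_2\le L_0$ and $\|\nabla^2_\theta\ell_\theta(z)\|_{\rm op}\le L_1$ for all $\theta\in\mathbb R^d$ and $z\in\mathcal X\times\mathcal Y$. Let $\lambda_{\rm reg}\ge0$ and $\theta_0\in\mathbb R^d$. For a sample of $n$ points of $\mathcal X\times\mathcal Y$ with empirical distribution $P_n$,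 let $\theta(P_n)$ be a minimizer of $\theta\mapsto P_n\ell_\theta+\frac{\lambda_{\rm reg}}2\|\theta-\theta_0\|_2^2$, and let $\lambda_{\min}(P_n)$ be the smallest eigenvalue of $P_n\nabla^2\ell_{\theta}$ at $\theta=\theta(P_n)$; if there is no minimizer, $\theta(P_n)$ is arbitrary and $\lambda_{\min}(P_n)=0$. Two samples are neighboring if they differ in at most one observation, i.e. their empirical distributions are at variation distance at most $1/n$. A mechanism $M$ is $(\varepsilon,\delta)$-differentially private if $\mathbb P(M(P_n)\in A)\le e^{\varepsilon}\,\mathbb P(M(P_n')\in A)+\delta$ for all neighboring samples and all measurable $A$. **Algorithm.** Let $\varepsilon>0$, $\delta\in(0,1)$. Put $$t(\lambda)=\frac{1-\sqrt{1-\frac{8\alpha rL_0}{\lambda n}}}{2\alpha r}$$ (read as its limit $\frac{2L_0}{\lambda n}$ if $\alpha r=0$), which is called *defined* if $\lambda>0$ and $8\alpha rL_0\le\lambda n$. Put $$\mathcal R(\lambda)=\Big[\lambda\,\big[1-\varphi\big(r\,t(\lambda+\lambda_{\rm reg})\big)\big]_+-\frac{L_1}{n}\Big]_+$$ if $\lambda+\frac{\lambda_{\rm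 reg}}{\rho}\ge\frac{4L_0\alpha r}{\rho(1-\rho)n}+\frac{L_1}{\rho n}$ and $t(\lambda+\lambda_{\rm reg})$ is defined, and $\mathcal R(\lambda)=0$ otherwise. Let $$\widehat N=\min\{N\in\mathbb N:\mathcal R^N(\lambda_{\min}(P_n))=0\}+\tfrac1\varepsilon W,$$ where $W$ has the standard Laplace distribution, and $$\widehat\lambda=\sup\big\{\lambda\ge0:\mathcal R^{m}(\lambda)=0\big\},\qquad m=\Big\lfloor\big[\widehat N-\tfrac1\varepsilon\log\tfrac1{2\delta}\big]_+\Big\rfloor .$$ Let $\Phi$ be the standard normal distribution function and $$\sigma^2(\varepsilon,\delta)=\inf\Big\{\sigma^2:\ \sigma>0,\ \Phi\big(-\sigma\varepsilon-\tfrac1{2\sigma}\big)+\Phi\big(-\sigma\varepsilon+\tfrac1{2\sigma}\big)\le\delta\Big\}.$$ If $t(\widehat\lambda+\lambda_{\rm reg})$ is not defined (in particular if $\widehat\lambda+\lambda_{\rm reg}=0$), output $\widehat\theta=\perp$; otherwise output $$\widehat\theta=\theta(P_n)+\mathsf N\big(0,\ \sigma^2(\varepsilon,\delta)\,t^2(\widehat\lambda+\lambda_{\rm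 reg})\,I_d\big),$$ with Gaussian noise independent of $W$. **Theorem.** 1. For all $\varepsilon>0$ and $\delta\in(0,1)$, the output $\widehat\theta$ is $(2\varepsilon,2\delta)$-differentially private. 2. For each $K<\infty$ there is a constant $0<C<\infty$, depending only on $\alpha$, $\rho$ and $K$, such that for all $\varepsilon>0$ and $\delta,\gamma\in(0,1)$ with $\varepsilon\le K\log\frac1\delta$ and every sample with $\lambda_{\min}(P_n)+\lambda_{\rm reg}>0$: if $$\lambda_{\min}(P_n)+\lambda_{\rm reg}\ \ge\ C\left(\frac1\varepsilon\log\frac1\delta\cdot\Big[\frac{L_1}n+\frac{L_0r}n\Big]+\frac{L_0r}n+\frac{L_1}n\right),$$ then with probability at least $1-\delta-\gamma$ the output is not $\perp$ and $$\big\|\widehat\theta-\theta(P_n)\big\|_2\ \le\ C\,\frac{L_0}{n(\lambda_{\min}(P_n)+\lambda_{\rm reg})}\cdot\frac1\varepsilon\sqrt{\log\frac1\delta}\,\Big[\sqrt d+\sqrt{\log\frac1\gamma}\Big].$$ -/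

import Mathlib

open MeasureTheory ProbabilityTheory
open scoped ENNReal

noncomputable section

namespace PrivateGLM

/-! ### Differential privacy -/

/-- Two samples of size `n`, read as unordered samples (that is, through their empirical
distributions), are neighboring if they differ in at most one observation.  Equivalently, their
empirical distributions are at variation distance at most `1 / n`. -/
def Neighboring {Z : Type*} {n : ℕ} (S S' : Fin n → Z) : Prop :=
  ∃ (σ : Equiv.Perm (Fin n)) (i : Fin n), ∀ j, j ≠ i → S' (σ j) = S j

/-- A randomized function `M` of samples of size `n`, with internal randomness `ω ∼ μ`,
is `(ε, δ)`-differentially private. -/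
def IsDP {Z Ω T : Type*} {n : ℕ} [MeasurableSpace Ω] [MeasurableSpace T]
    (μ : Measure Ω) (M : (Fin n → Z) → Ω → T) (ε δ : ℝ) : Prop :=
  ∀ S S' : Fin n → Z, Neighboring S S' → ∀ A : Set T, MeasurableSet A →
    μ {ω | M S ω ∈ A} ≤
      ENNReal.ofReal (Real.exp ε) * μ {ω | M S' ω ∈ A} + ENNReal.ofReal δ

/-- The Laplace distribution with location `0` and scale `1`, of density `exp (-|x|) / 2`. -/
def laplaceOne : Measure ℝ :=
  (volume : Measure ℝ).withDensity fun x => ENNReal.ofReal (Real.exp (-|x|) / 2)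

/-- The `(ε, δ)`-variance
`σ²(ε, δ) = inf {σ² | Φ(-σ ε - 1/(2σ)) + Φ(-σ ε + 1/(2σ)) ≤ δ}`, the infimum being over `σ > 0`,
where `Φ` is the standard normal distribution function. -/
def privVariance (ε δ : ℝ) : ℝ :=
  sInf {v : ℝ | ∃ σ : ℝ, 0 < σ ∧ v = σ ^ 2 ∧
    cdf (gaussianReal 0 1) (-σ * ε - 1 / (2 * σ))
      + cdf (gaussianReal 0 1) (-σ * ε + 1 / (2 * σ)) ≤ δ}

/-! ### Quasi-self-concordant generalized linear models -/

/-- A function `f` on the line is `φ`-quasi-self-concordant if it is convex, twice continuously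
differentiable, and
`f''(t) [1 - φ(|s|)]₊ ≤ f''(t + s) ≤ f''(t) (1 + φ(|s|))` for all `t`, `s`.
The function `φ` may take the value `∞`; subtraction in `ℝ≥0∞` is truncated at `0`. -/
def IsQSC (φ : ℝ → ℝ≥0∞) (f : ℝ → ℝ) : Prop :=
  ConvexOn ℝ Set.univ f ∧ ContDiff ℝ 2 f ∧
    ∀ t s : ℝ,
      ENNReal.ofReal (deriv (deriv f) t) * (1 - φ |s|) ≤
          ENNReal.ofReal (deriv (deriv f) (t + s)) ∧
        ENNReal.ofReal (deriv (deriv f) (t + s)) ≤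
          ENNReal.ofReal (deriv (deriv f) t) * (1 + φ |s|)

/-- The Hessian of a function on a Euclidean space, as an operator. -/
def hessian {d : ℕ} (f : EuclideanSpace ℝ (Fin d) → ℝ) (θ : EuclideanSpace ℝ (Fin d)) :
    EuclideanSpace ℝ (Fin d) →L[ℝ] EuclideanSpace ℝ (Fin d) :=
  fderiv ℝ (gradient f) θ

/-- The smallest eigenvalue of an operator on a Euclidean space. -/
def minEigenvalue {d : ℕ}
    (H : EuclideanSpace ℝ (Fin d) →L[ℝ] EuclideanSpace ℝ (Fin d)) : ℝ :=
  sInf {μ : ℝ | Module.End.HasEigenvalue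
    (H : EuclideanSpace ℝ (Fin d) →ₗ[ℝ] EuclideanSpace ℝ (Fin d)) μ}

/-- A regularized estimation problem with a quasi-self-concordant generalized linear model loss
`ℓ_θ(x, y) = h(⟨θ, x⟩, y)`, whose self-concordance function `φ` has the linear bound
`φ(t) ≤ α t` for `0 ≤ t ≤ (1 - ρ) / α`. -/
structure GLM (α ρ : ℝ) (d : ℕ) (Y : Type*) where
  /-- the domain of the covariates -/
  X : Set (EuclideanSpace ℝ (Fin d))
  bounded_X : Bornology.IsBounded X
  /-- the loss as a function of the linear predictor -/
  h : ℝ → Y → ℝ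
  /-- the self-concordance function -/
  φ : ℝ → ℝ≥0∞
  monotone_φ : MonotoneOn φ (Set.Ici 0)
  qsc : ∀ y, IsQSC φ fun t => h t y
  φ_le : ∀ t, 0 ≤ t → α * t ≤ 1 - ρ → φ t ≤ ENNReal.ofReal (α * t)
  /-- the Lipschitz constant of the loss -/
  L₀ : ℝ
  /-- the Lipschitz constant of the gradient of the loss -/
  L₁ : ℝ
  norm_gradient_le : ∀ x ∈ X, ∀ (y : Y) (θ : EuclideanSpace ℝ (Fin d)),
    ‖gradient (fun θ' => h (inner ℝ θ' x) y) θ‖ ≤ L₀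
  norm_hessian_le : ∀ x ∈ X, ∀ (y : Y) (θ : EuclideanSpace ℝ (Fin d)),
    ‖hessian (fun θ' => h (inner ℝ θ' x) y) θ‖ ≤ L₁
  /-- the regularization parameter -/
  lamReg : ℝ
  lamReg_nonneg : 0 ≤ lamReg
  /-- the center of the regularization -/
  θ₀ : EuclideanSpace ℝ (Fin d)

namespace GLM

variable {α ρ : ℝ} {d : ℕ} {Y : Type*} (P : GLM α ρ d Y)

/-- The loss `ℓ_θ(z)` of the parameter `θ` at the observation `z = (x, y)`. -/
def loss (z : P.X × Y) (θ : EuclideanSpace ℝ (Fin d)) : ℝ :=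
  P.h (inner ℝ θ (z.1 : EuclideanSpace ℝ (Fin d))) z.2

/-- The radius `r = sup {‖x‖ | x ∈ X}` of the covariate domain. -/
def radius : ℝ := sSup ((fun x => ‖x‖) '' P.X)

/-- The regularized empirical loss `P_n ℓ_θ + (λ_reg / 2) ‖θ - θ₀‖²`. -/
def objective {n : ℕ} (S : Fin n → P.X × Y) (θ : EuclideanSpace ℝ (Fin d)) : ℝ :=
  (1 / (n : ℝ)) * ∑ i, P.loss (S i) θ + P.lamReg / 2 * ‖θ - P.θ₀‖ ^ 2

/-- `θ` minimizes the regularized empirical loss of the sample `S`. -/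
def IsArgmin {n : ℕ} (S : Fin n → P.X × Y) (θ : EuclideanSpace ℝ (Fin d)) : Prop :=
  ∀ θ', P.objective S θ ≤ P.objective S θ'

/-- `θ` is a choice of `θ(P_n)`: it is a minimizer of the regularized empirical loss for each
sample that has one, and arbitrary for the samples without a minimizer. -/
def IsEstimator {n : ℕ} (θ : (Fin n → P.X × Y) → EuclideanSpace ℝ (Fin d)) : Prop :=
  ∀ S, (∃ v, P.IsArgmin S v) → P.IsArgmin S (θ S)

/-- The Hessian `P_n ℓ''_θ` of the (unregularized) empirical loss. -/
def empHessian {n : ℕ} (S : Fin n → P.X × Y) (θ : EuclideanSpace ℝ (Fin d)) :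
    EuclideanSpace ℝ (Fin d) →L[ℝ] EuclideanSpace ℝ (Fin d) :=
  (1 / (n : ℝ)) • ∑ i, hessian (P.loss (S i)) θ

open Classical in
/-- `λ_min(P_n)`, the smallest eigenvalue of the empirical Hessian at `θ(P_n)`, with the
convention that it is `0` if the regularized empirical loss has no minimizer. -/
def lamMin {n : ℕ} (θ : (Fin n → P.X × Y) → EuclideanSpace ℝ (Fin d))
    (S : Fin n → P.X × Y) : ℝ :=
  if ∃ v, P.IsArgmin S v then minEigenvalue (P.empHessian S (θ S)) else 0

/-! ### The algorithms -/

/-- The condition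
`λ + λ_reg / ρ ≥ 4 L₀ α r / (ρ (1 - ρ) n) + L₁ / (ρ n)`. -/
def LargeEnough (n : ℕ) (lam : ℝ) : Prop :=
  4 * P.L₀ * α * P.radius / (ρ * (1 - ρ) * n) + P.L₁ / (ρ * n) ≤ lam + P.lamReg / ρ

/-- The parameter change bound
`t(λ) = (1 - √(1 - 8 α r L₀ / (λ n))) / (2 α r)`, which for `α r = 0` is
read as the limit `2 L₀ / (λ n)` of that expression. -/
def paramChange (n : ℕ) (lam : ℝ) : ℝ :=
  if α * P.radius = 0 then 2 * P.L₀ / (lam * n)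
  else (1 - Real.sqrt (1 - 8 * α * P.radius * P.L₀ / (lam * n))) / (2 * α * P.radius)

/-- The arguments `λ` at which the expression `t(λ)` is meaningful: `λ > 0`, and the number under
the square root is nonnegative. -/
def ParamChangeDefined (n : ℕ) (lam : ℝ) : Prop :=
  0 < lam ∧ 8 * α * P.radius * P.L₀ / (lam * n) ≤ 1

open Classical in
/-- The recursion
`R(λ) = [λ [1 - φ(r t(λ + λ_reg))]₊ - L₁ / n]₊` if `λ` satisfies `LargeEnough` (and `t(λ + λ_reg)`
is defined), and `R(λ) = 0` otherwise. -/
def recursion (n : ℕ) (lam : ℝ) : ℝ :=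
  if P.LargeEnough n lam ∧ P.ParamChangeDefined n (lam + P.lamReg) then
    max (lam * (1 - P.φ (P.radius * P.paramChange n (lam + P.lamReg))).toReal - P.L₁ / n) 0
  else 0

/-- `min {N | R^N(λ_min(P_n)) = 0}`. -/
def stepCount {n : ℕ} (θ : (Fin n → P.X × Y) → EuclideanSpace ℝ (Fin d))
    (S : Fin n → P.X × Y) : ℕ :=
  sInf {N : ℕ | (P.recursion n)^[N] (P.lamMin θ S) = 0}

/-- The private count `N̂ = min {N | R^N(λ_min(P_n)) = 0} + w / ε`, where `w` is the Laplace noise. -/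
def noisyCount {n : ℕ} (θ : (Fin n → P.X × Y) → EuclideanSpace ℝ (Fin d)) (ε : ℝ)
    (S : Fin n → P.X × Y) (w : ℝ) : ℝ :=
  P.stepCount θ S + (1 / ε) * w

/-- The private eigenvalue lower bound
`λ̂ = sup {λ ≥ 0 | R^m(λ) = 0}`, where `m = ⌊[N̂ - k]₊⌋` and `k = (1 / ε) log (1 / (2 δ))`. -/
def lamHat {n : ℕ} (θ : (Fin n → P.X × Y) → EuclideanSpace ℝ (Fin d)) (ε δ : ℝ)
    (S : Fin n → P.X × Y) (w : ℝ) : ℝ :=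
  sSup {lam : ℝ | 0 ≤ lam ∧
    (P.recursion n)^[⌊max (P.noisyCount θ ε S w - (1 / ε) * Real.log (1 / (2 * δ))) 0⌋₊] lam = 0}

open Classical in
/-- The release of `θ(P_n)` by local output perturbation, as a function of the Laplace noise `ω.1`
and of the standard Gaussian vector `ω.2`.  The output is
`θ(P_n) + σ(ε, δ) t(λ̂ + λ_reg) ω.2`, or `⊥` (the second summand of the output type) if
`λ̂ + λ_reg = 0` or, more generally, if `t(λ̂ + λ_reg)` is not defined. -/
def release {n : ℕ} (θ : (Fin n → P.X × Y) → EuclideanSpace ℝ (Fin d)) (ε δ : ℝ)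
    (S : Fin n → P.X × Y) (ω : ℝ × EuclideanSpace ℝ (Fin d)) :
    EuclideanSpace ℝ (Fin d) ⊕ Unit :=
  if P.ParamChangeDefined n (P.lamHat θ ε δ S ω.1 + P.lamReg) then
    Sum.inl (θ S + (Real.sqrt (privVariance ε δ) *
      P.paramChange n (P.lamHat θ ε δ S ω.1 + P.lamReg)) • ω.2)
  else Sum.inr ()

end GLM

/-- The law of the internal randomness of the release: independent standard Laplace and
standard Gaussian noise. -/
def noiseLaw (d : ℕ) : Measure (ℝ × EuclideanSpace ℝ (Fin d)) :=
  laplaceOne.prod (stdGaussian (EuclideanSpace ℝ (Fin d)))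

end PrivateGLM

end

/-! Stability comes from convexity along rays. If the regularized loss is `κ`-strongly convex within
distance `T` of its minimizer, its directional derivative at distance `T` is at least `κ T`.
Replacing one observation changes unit directional derivatives by at most `2 L₀ / n`, so `κ T ≥ 2 L₀
/ n` confines the new minimizer to that ball (`IsArgmin.stable`). Self-concordance allows `κ = (λ +
λ_reg) (1 - α r T)`, and `t(λ + λ_reg)` is the smaller root of `κ T = 2 L₀ / n`.

The radius depends on the private quantity `λ_min`. Within the ball the curvature keeps the factor
`[1 - φ(r T)]₊`, and the replaced observation costs at most `L₁ / n`, so `R(λ_min(S)) ≤ λ_min(S')`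
(`recursion_lamMin_le`). As `R` is monotone, the number of iterations taking `λ_min` to zero has
sensitivity one, and Laplace noise privatizes it. Unless the noisy count overshoots, which has
probability at most `δ`, inverting the recursion gives a lower bound for `λ_min`, or the count is
zero and regularization alone gives stability. Given a common count, the release is a Gaussian
mechanism with a valid sensitivity. Integrating over the Laplace noise adds the two privacy budgets.

For accuracy, above the thresholds each application of `R` loses at most `(4 α r L₀ + L₁) / n`. With
probability at least `1 - δ` the count undershoots by at most `1 + (2 / ε) log (1 / δ)`. The lower
bound on `λ_min + λ_reg` therefore ensures that at least half of it survives in `λ̂ + λ_reg`. Bounds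
on `t`, on the calibrated variance and on the Gaussian norm then finish the estimate. -/

noncomputable section

namespace PrivateGLM

/-! ### Standard Gaussian vectors: density, translations and norm tails -/

section Gaussian

variable {E : Type*} [NormedAddCommGroup E] [InnerProductSpace ℝ E] [FiniteDimensional ℝ E]
  [MeasurableSpace E] [BorelSpace E]

/-- The density of the standard Gaussian distribution on a Euclidean space. -/
def stdGaussianPDF (x : E) : ℝ :=
  (2 * Real.pi) ^ (-(Module.finrank ℝ E / 2 : ℝ)) * Real.exp (-(1 / 2) * ‖x‖ ^ 2)

omit [FiniteDimensional ℝ E] [MeasurableSpace E] [BorelSpace E] in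
lemma stdGaussianPDF_nonneg (x : E) : 0 ≤ stdGaussianPDF x := by
  unfold stdGaussianPDF; positivity

omit [FiniteDimensional ℝ E] [MeasurableSpace E] [BorelSpace E] in
lemma continuous_stdGaussianPDF : Continuous (stdGaussianPDF : E → ℝ) := by
  unfold stdGaussianPDF; fun_prop

lemma integrable_exp_neg_mul_sq_norm {b : ℝ} (hb : 0 < b) :
    Integrable fun x : E => Real.exp (-b * ‖x‖ ^ 2) := by
  have h := (GaussianFourier.integrable_cexp_neg_mul_sq_norm_add (V := E) (b := (b : ℂ))
    (by simpa using hb) 0 0).norm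
  refine h.congr (ae_of_all _ fun x => ?_)
  have : (-(b : ℂ) * (‖x‖ : ℂ) ^ 2 + 0 * (inner ℝ (0 : E) x : ℂ)) = ((-b * ‖x‖ ^ 2 : ℝ) : ℂ) := by
    push_cast; ring
  simp only [this, Complex.norm_exp, Complex.ofReal_re]

lemma integrable_stdGaussianPDF : Integrable (stdGaussianPDF : E → ℝ) :=
  (integrable_exp_neg_mul_sq_norm (by norm_num)).const_mul _

/-- Both measures have the same characteristic function; the Fourier integral of the Gaussian
produces exactly the inverse of the normalizing constant. -/
lemma stdGaussian_eq_withDensity :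
    stdGaussian E = volume.withDensity fun x => ENNReal.ofReal (stdGaussianPDF x) := by
  have := isFiniteMeasure_withDensity_ofReal (μ := volume)
    (integrable_stdGaussianPDF (E := E)).hasFiniteIntegral
  apply Measure.ext_of_charFun
  ext t
  rw [charFun_stdGaussian, charFun_apply, integral_withDensity_eq_integral_toReal_smul
    (by have := continuous_stdGaussianPDF (E := E); fun_prop) (by simp)]
  have h := GaussianFourier.integral_cexp_neg_mul_sq_norm_add (V := E) (b := (1 / 2 : ℂ))
    (by norm_num) Complex.I t
  have hc : ((2 * Real.pi : ℝ) ^ (-(Module.finrank ℝ E / 2 : ℝ)) : ℝ) *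
      (Real.pi / (1 / 2 : ℂ)) ^ (Module.finrank ℝ E / 2 : ℂ) = 1 := by
    have e : (Real.pi / (1 / 2 : ℂ)) = ((2 * Real.pi : ℝ) : ℂ) := by push_cast; ring
    have e2 : (Module.finrank ℝ E / 2 : ℂ) = ((Module.finrank ℝ E / 2 : ℝ) : ℂ) := by push_cast; ring
    rw [e, e2, ← Complex.ofReal_cpow (by positivity), ← Complex.ofReal_mul,
      ← Real.rpow_add (by positivity)]
    simp
  calc Complex.exp (-‖t‖ ^ 2 / 2)
      = ((2 * Real.pi : ℝ) ^ (-(Module.finrank ℝ E / 2 : ℝ)) : ℝ) *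
        ∫ v : E, Complex.exp (-(1 / 2 : ℂ) * ‖v‖ ^ 2 + Complex.I * (inner ℝ t v : ℝ)) := by
        rw [h, ← mul_assoc, hc, one_mul]
        congr 1
        rw [Complex.I_sq]; ring
    _ = _ := by
        rw [← integral_const_mul]
        refine integral_congr_ae (ae_of_all _ fun v => ?_)
        dsimp only
        rw [ENNReal.toReal_ofReal (stdGaussianPDF_nonneg v), stdGaussianPDF, Complex.real_smul]
        rw [Complex.exp_add]
        push_cast
        rw [real_inner_comm t v, mul_comm Complex.I]
        ring

lemma stdGaussian_apply {s : Set E} (hs : MeasurableSet s) :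
    stdGaussian E s = ∫⁻ x in s, ENNReal.ofReal (stdGaussianPDF x) := by
  rw [stdGaussian_eq_withDensity, withDensity_apply _ hs]

/-- A privacy inequality for the translation of a standard Gaussian vector: up to the factor
`exp ε`, it is violated only on the event that the privacy loss exceeds `ε`. -/
lemma stdGaussian_le_translate {s : Set E} (hs : MeasurableSet s) (u : E) (ε : ℝ) :
    stdGaussian E s ≤ ENNReal.ofReal (Real.exp ε) * stdGaussian E {g | g + u ∈ s} +
      stdGaussian E {g | ε < ‖u‖ ^ 2 / 2 - inner ℝ u g} := by
  set B : Set E := {g | ε < ‖u‖ ^ 2 / 2 - inner ℝ u g} with hB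
  have hBm : MeasurableSet B := measurableSet_lt (by fun_prop) (by fun_prop)
  have hm : Measurable fun x : E => ENNReal.ofReal (stdGaussianPDF x) := by
    have := continuous_stdGaussianPDF (E := E); fun_prop
  calc stdGaussian E s ≤ stdGaussian E (s \ B) + stdGaussian E B := by
        refine (measure_mono ?_).trans (measure_union_le _ _)
        intro x hx; by_cases h : x ∈ B
        · exact Or.inr h
        · exact Or.inl ⟨hx, h⟩
    _ ≤ _ := by
        gcongr
        have hsu : MeasurableSet {g : E | g + u ∈ s} := hs.preimage (by fun_prop)
        rw [stdGaussian_apply (hs.diff hBm), stdGaussian_apply hsu,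
          ← lintegral_const_mul _ hm, ← lintegral_indicator (hs.diff hBm),
          ← lintegral_indicator hsu,
          ← lintegral_sub_right_eq_self (μ := (volume : Measure E))
            (Set.indicator {g : E | g + u ∈ s} _) u]
        refine lintegral_mono fun x => ?_
        by_cases hx : x ∈ s \ B
        · have hx' : x - u ∈ {g : E | g + u ∈ s} := by simpa using hx.1
          rw [Set.indicator_of_mem hx, Set.indicator_of_mem hx', ← ENNReal.ofReal_mul (by positivity)]
          apply ENNReal.ofReal_le_ofReal
          have h2 : ‖u‖ ^ 2 / 2 - inner ℝ u x ≤ ε := not_lt.1 hx.2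
          unfold stdGaussianPDF
          rw [mul_left_comm, ← Real.exp_add]
          gcongr
          rw [norm_sub_sq_real, real_inner_comm]
          linarith
        · rw [Set.indicator_of_notMem hx]; exact bot_le

lemma stdGaussian_map_inner (u : E) :
    (stdGaussian E).map (fun g => inner ℝ u g) = gaussianReal 0 (‖u‖₊ ^ 2) := by
  have h := IsGaussian.map_eq_gaussianReal (μ := stdGaussian E) (innerSL ℝ u)
  rw [integral_strongDual_stdGaussian, variance_dual_stdGaussian] at h
  have e : (fun g : E => inner ℝ u g) = innerSL ℝ u := by ext; simp
  rw [e, h]; congr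
  ext; simp

/-- The exponential moment for a Chernoff bound on the norm: the tilt leaves the weight `exp (-‖x‖²
/ 4)`, a Gaussian of doubled variance. -/
lemma lintegral_exp_quarter_sq_norm :
    ∫⁻ x, ENNReal.ofReal (Real.exp (‖x‖ ^ 2 / 4)) ∂stdGaussian E =
      ENNReal.ofReal (2 ^ (Module.finrank ℝ E / 2 : ℝ)) := by
  have hm : Measurable fun x : E => ENNReal.ofReal (stdGaussianPDF x) := by
    have := continuous_stdGaussianPDF (E := E); fun_prop
  rw [stdGaussian_eq_withDensity, lintegral_withDensity_eq_lintegral_mul _ hm (by fun_prop)]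
  have e : ∀ x : E, ((fun x : E => ENNReal.ofReal (stdGaussianPDF x)) *
      (fun x : E => ENNReal.ofReal (Real.exp (‖x‖ ^ 2 / 4))) : E → ℝ≥0∞) x =
      ENNReal.ofReal ((2 * Real.pi) ^ (-(Module.finrank ℝ E / 2 : ℝ)) *
        Real.exp (-(1 / 4) * ‖x‖ ^ 2)) := fun x => by
    rw [Pi.mul_apply, ← ENNReal.ofReal_mul (stdGaussianPDF_nonneg x), stdGaussianPDF, mul_assoc,
      ← Real.exp_add]
    ring_nf
  rw [lintegral_congr e, ← ofReal_integral_eq_lintegral_ofReal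
    ((integrable_exp_neg_mul_sq_norm (by norm_num)).const_mul _)
    (ae_of_all _ fun x => by positivity), integral_const_mul,
    GaussianFourier.integral_rexp_neg_mul_sq_norm (by norm_num)]
  congr 1
  rw [show Real.pi / (1 / 4 : ℝ) = 2 * (2 * Real.pi) by ring,
    Real.mul_rpow (x := 2) (y := 2 * Real.pi) (by norm_num) (by positivity), mul_left_comm,
    ← Real.rpow_add (by positivity)]
  simp

/-- A tail bound for the norm of a standard Gaussian vector. -/
lemma stdGaussian_norm_gt_le {γ : ℝ} (hγ : 0 < γ) (hγ1 : γ < 1) :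
    stdGaussian E {g | 2 * (Real.sqrt (Module.finrank ℝ E) + Real.sqrt (Real.log (1 / γ))) < ‖g‖} ≤
      ENNReal.ofReal γ := by
  set D : ℝ := (Module.finrank ℝ E : ℝ)
  set l := Real.log (1 / γ)
  have hl : 0 ≤ l := Real.log_nonneg (by rw [le_div_iff₀ hγ]; linarith)
  have hD : 0 ≤ D := Nat.cast_nonneg _
  -- The threshold is `exp (D + l)` because `(√D + √l)² ≥ D + l`. The moment `2 ^ (D / 2)` is
  -- absorbed by `exp D`, leaving `exp (-l) = γ`.
  have h1 := meas_ge_le_lintegral_div (μ := stdGaussian E)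
    (f := fun x => ENNReal.ofReal (Real.exp (‖x‖ ^ 2 / 4))) (by fun_prop)
    (ε := ENNReal.ofReal (Real.exp (D + l))) (by simp [Real.exp_pos]) (by simp)
  rw [lintegral_exp_quarter_sq_norm] at h1
  refine (measure_mono fun g hg => ?_).trans (h1.trans ?_)
  · apply ENNReal.ofReal_le_ofReal
    apply Real.exp_le_exp.2
    have hg' : 2 * (Real.sqrt D + Real.sqrt l) < ‖g‖ := hg
    have a := Real.sq_sqrt hD
    have b := Real.sq_sqrt hl
    have c := Real.sqrt_nonneg D
    have d := Real.sqrt_nonneg l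
    nlinarith [mul_nonneg c d]
  · rw [← ENNReal.ofReal_div_of_pos (Real.exp_pos _)]
    apply ENNReal.ofReal_le_ofReal
    rw [div_le_iff₀ (Real.exp_pos _), Real.exp_add]
    have : Real.exp l = 1 / γ := Real.exp_log (by positivity)
    rw [this, mul_comm, mul_assoc, one_div_mul_cancel hγ.ne', mul_one,
      Real.rpow_def_of_pos (by norm_num)]
    apply Real.exp_le_exp.2
    have := Real.log_two_lt_d9
    nlinarith

end Gaussian

/-! ### Scalar Gaussian tails and the calibrated variance -/

section Real

local notation "Q" => gaussianReal 0 1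

lemma gaussianReal_neg_preimage {s : Set ℝ} (hs : MeasurableSet s) :
    Q ((fun x => -x) ⁻¹' s) = Q s := by
  have h := gaussianReal_map_neg (μ := 0) (v := 1)
  rw [neg_zero] at h
  conv_rhs => rw [← h]
  rw [Measure.map_apply measurable_neg hs]

lemma gaussianReal_Iic_zero : Q (Set.Iic 0) ≤ ENNReal.ofReal (1 / 2) := by
  have := nullSingletonClass_gaussianReal (μ := 0) (v := 1) one_ne_zero
  have h1 : Q (Set.Ioi 0) = Q (Set.Iic 0) := by
    rw [← gaussianReal_neg_preimage measurableSet_Ioi]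
    have : (fun x : ℝ => -x) ⁻¹' Set.Ioi 0 = Set.Iio 0 := by ext; simp
    rw [this, measure_congr Iio_ae_eq_Iic]
  have h2 : Q (Set.Iic 0) + Q (Set.Ioi 0) = 1 := by
    rw [← measure_union (by simp) measurableSet_Ioi]
    simp
  rw [h1, ← two_mul] at h2
  rw [one_div, ENNReal.ofReal_inv_of_pos two_pos, ENNReal.ofReal_ofNat]
  exact (ENNReal.eq_inv_of_mul_eq_one_left (by rw [mul_comm]; exact h2)).le

/-- The Gaussian tail bound `Φ(-x) ≤ exp (-x² / 2) / 2`. -/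
lemma cdf_gaussianReal_neg_le {x : ℝ} (hx : 0 ≤ x) :
    cdf Q (-x) ≤ Real.exp (-x ^ 2 / 2) / 2 := by
  have hm : Measurable (gaussianPDF 0 1) := measurable_gaussianPDF 0 1
  have key : Q (Set.Iic (-x)) ≤ ENNReal.ofReal (Real.exp (-x ^ 2 / 2)) * Q (Set.Iic 0) := by
    rw [gaussianReal_apply _ one_ne_zero, gaussianReal_apply _ one_ne_zero,
      ← lintegral_const_mul _ hm, ← lintegral_indicator measurableSet_Iic,
      ← lintegral_indicator measurableSet_Iic,
      ← lintegral_sub_right_eq_self (μ := (volume : Measure ℝ))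
        (Set.indicator (Set.Iic (-x)) _) x]
    -- After the translation, `(s - x)² ≥ s² + x²` for `s ≤ 0 ≤ x` compares the densities.
    refine lintegral_mono fun s => ?_
    by_cases hs : s ≤ 0
    · rw [Set.indicator_of_mem (show s - x ∈ Set.Iic (-x) by simpa using hs),
        Set.indicator_of_mem (show s ∈ Set.Iic 0 from hs), gaussianPDF, gaussianPDF,
        ← ENNReal.ofReal_mul (Real.exp_pos _).le]
      apply ENNReal.ofReal_le_ofReal
      simp only [gaussianPDFReal]
      rw [mul_left_comm, ← Real.exp_add]
      gcongr
      simp only [NNReal.coe_one]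
      nlinarith [mul_nonneg (neg_nonneg.2 hs) hx]
    · rw [Set.indicator_of_notMem (by simpa using hs)]; exact bot_le
  have h2 : ENNReal.ofReal (cdf Q (-x)) ≤ ENNReal.ofReal (Real.exp (-x ^ 2 / 2) * (1 / 2)) := by
    rw [ofReal_cdf, ENNReal.ofReal_mul (Real.exp_pos _).le]
    exact key.trans (by gcongr; exact gaussianReal_Iic_zero)
  have := (ENNReal.ofReal_le_ofReal_iff (by positivity)).1 h2
  linarith

/-- Standard deviations of order `√(log (1 / δ)) / ε` meet the privacy constraint. -/
lemma cdf_add_cdf_le {ε δ K : ℝ} (hε : 0 < ε) (hδ : 0 < δ) (hδ1 : δ < 1) (hK : 0 ≤ K)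
    (h : ε ≤ K * Real.log (1 / δ)) {σ : ℝ} (hσ : σ = (2 + K) * Real.sqrt (Real.log (1 / δ)) / ε) :
    0 < σ ∧ cdf Q (-σ * ε - 1 / (2 * σ)) + cdf Q (-σ * ε + 1 / (2 * σ)) ≤ δ := by
  have hl : 0 < Real.log (1 / δ) := Real.log_pos (by rw [lt_div_iff₀ hδ]; linarith)
  set l := Real.log (1 / δ) with hldef
  have hs : 0 < Real.sqrt l := Real.sqrt_pos.2 hl
  have hss := Real.sq_sqrt hl.le
  have hσ0 : 0 < σ := by rw [hσ]; positivity
  refine ⟨hσ0, ?_⟩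
  have e1 : σ * ε = (2 + K) * Real.sqrt l := by rw [hσ]; field_simp
  have e2 : 1 / (2 * σ) ≤ Real.sqrt l / 2 := by
    rw [div_le_iff₀ (by positivity), hσ]
    have : ε ≤ (2 + K) * l := h.trans (by nlinarith)
    have h3 : Real.sqrt l / 2 * (2 * ((2 + K) * Real.sqrt l / ε)) = ((2 + K) * l) / ε := by
      field_simp; linarith
    rw [h3, le_div_iff₀ hε]; linarith
  -- Here `σ ε ≥ 2 √l` and `1 / (2 σ) ≤ √l / 2`. Each of the two tails is then at most `exp (-9 l /
  -- 8) / 2 ≤ δ / 2`.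
  have e3 : -σ * ε + 1 / (2 * σ) ≤ -(3 / 2 * Real.sqrt l) := by nlinarith
  have hp : 0 < 1 / (2 * σ) := by positivity
  have t1 := (monotone_cdf Q e3).trans (cdf_gaussianReal_neg_le (by positivity))
  have t2 := (monotone_cdf Q (show -σ * ε - 1 / (2 * σ) ≤ -(3 / 2 * Real.sqrt l) by linarith)).trans
    (cdf_gaussianReal_neg_le (by positivity))
  have t3 : Real.exp (-(3 / 2 * Real.sqrt l) ^ 2 / 2) ≤ δ := by
    have : δ = Real.exp (-l) := by
      rw [hldef, one_div, Real.log_inv, neg_neg, Real.exp_log hδ]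
    rw [this]
    apply Real.exp_le_exp.2
    rw [mul_pow, hss]; linarith
  linarith

lemma privVariance_le {ε δ σ : ℝ} (hσ : 0 < σ)
    (h : cdf Q (-σ * ε - 1 / (2 * σ)) + cdf Q (-σ * ε + 1 / (2 * σ)) ≤ δ) :
    privVariance ε δ ≤ σ ^ 2 :=
  csInf_le ⟨0, by rintro _ ⟨σ, _, rfl, _⟩; positivity⟩ ⟨σ, hσ, rfl, h⟩

lemma sqrt_privVariance_le {ε δ K : ℝ} (hε : 0 < ε) (hδ : 0 < δ) (hδ1 : δ < 1) (hK : 0 ≤ K)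
    (h : ε ≤ K * Real.log (1 / δ)) :
    Real.sqrt (privVariance ε δ) ≤ (2 + K) * Real.sqrt (Real.log (1 / δ)) / ε := by
  obtain ⟨h1, h2⟩ := cdf_add_cdf_le hε hδ hδ1 hK h rfl
  exact (Real.sqrt_le_left h1.le).2 (privVariance_le h1 h2)

/-- The expression `-σ ε + 1 / (2 σ)` decreases in `σ`, so each `σ` above the infimum inherits the
bound from a feasible smaller value. The other tail is nonnegative and is dropped. -/
lemma cdf_le_of_sqrt_privVariance_lt {ε δ σ : ℝ} (hε : 0 < ε) (hδ : 0 < δ) (hδ1 : δ < 1)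
    (hσ : Real.sqrt (privVariance ε δ) < σ) : cdf Q (-σ * ε + 1 / (2 * σ)) ≤ δ := by
  have hl : 0 < Real.log (1 / δ) := Real.log_pos (by rw [lt_div_iff₀ hδ]; linarith)
  -- This choice of `K` turns the size condition on `ε` into an equality; the resulting `σ` shows
  -- that the feasible set is nonempty.
  obtain ⟨h1, h2⟩ := cdf_add_cdf_le hε hδ hδ1 (K := ε / Real.log (1 / δ)) (by positivity)
    (by rw [div_mul_cancel₀ _ hl.ne']) rfl
  have hσ0 : 0 < σ := (Real.sqrt_nonneg _).trans_lt hσ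
  obtain ⟨_, ⟨τ, hτ, rfl, h⟩, hlt⟩ := exists_lt_of_csInf_lt
    (s := {v : ℝ | ∃ σ : ℝ, 0 < σ ∧ v = σ ^ 2 ∧
      cdf Q (-σ * ε - 1 / (2 * σ)) + cdf Q (-σ * ε + 1 / (2 * σ)) ≤ δ})
    ⟨_, _, h1, rfl, h2⟩ ((Real.sqrt_lt' hσ0).1 hσ)
  have hτσ : τ ≤ σ := (lt_of_pow_lt_pow_left₀ 2 hσ0.le hlt).le
  have hle : -σ * ε + 1 / (2 * σ) ≤ -τ * ε + 1 / (2 * τ) := by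
    have : 1 / (2 * σ) ≤ 1 / (2 * τ) := by gcongr
    nlinarith
  have := monotone_cdf Q hle
  have := cdf_nonneg Q (-τ * ε - 1 / (2 * τ))
  linarith

/-- If the infimum were zero, arbitrarily small `σ` would satisfy the tail bound, but the tail tends
to `1 > δ` as `σ → 0`. -/
lemma sqrt_privVariance_pos {ε δ : ℝ} (hε : 0 < ε) (hδ : 0 < δ) (hδ1 : δ < 1) :
    0 < Real.sqrt (privVariance ε δ) := by
  refine (Real.sqrt_nonneg _).lt_of_ne' fun h0 => ?_
  have h : Filter.Tendsto (fun s : ℝ => cdf Q (-s⁻¹ * ε + 1 / (2 * s⁻¹))) Filter.atTop (nhds 1) := by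
    refine (tendsto_cdf_atTop Q).comp ?_
    have h1 : Filter.Tendsto (fun s : ℝ => s / 2 - ε) Filter.atTop Filter.atTop :=
      Filter.tendsto_atTop_add_const_right _ _ (Filter.tendsto_id.atTop_div_const two_pos)
    refine Filter.tendsto_atTop_mono' _ ?_ h1
    filter_upwards [Filter.eventually_ge_atTop 1] with s hs
    have : s⁻¹ ≤ 1 := inv_le_one_of_one_le₀ hs
    have e : 1 / (2 * s⁻¹) = s / 2 := by field_simp
    rw [e]; nlinarith
  have := le_of_tendsto h (b := δ) (by
    filter_upwards [Filter.eventually_gt_atTop 0] with s hs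
    exact cdf_le_of_sqrt_privVariance_lt hε hδ hδ1 (by rw [h0]; positivity))
  linarith

/-- Attainment of the infimum is not needed. The bound holds for all larger `σ`; by continuity it
holds on every half-line ending strictly below `a`, and these exhaust the open half-line. -/
lemma gaussianReal_Iio_sqrt_privVariance_le {ε δ : ℝ} (hε : 0 < ε) (hδ : 0 < δ) (hδ1 : δ < 1) :
    Q (Set.Iio (-Real.sqrt (privVariance ε δ) * ε + 1 / (2 * Real.sqrt (privVariance ε δ)))) ≤
      ENNReal.ofReal δ := by
  set σ := Real.sqrt (privVariance ε δ)
  have hσ : 0 < σ := sqrt_privVariance_pos hε hδ hδ1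
  set a := -σ * ε + 1 / (2 * σ) with ha
  have h1 : ∀ z < a, Q (Set.Iic z) ≤ ENNReal.ofReal δ := fun z hz => by
    have hc : ContinuousAt (fun s : ℝ => -s * ε + 1 / (2 * s)) σ := by
      have : 2 * σ ≠ 0 := by positivity
      fun_prop (disch := assumption)
    have h2 := (hc.eventually (lt_mem_nhds hz)).filter_mono
      (nhdsWithin_le_nhds (s := Set.Ioi σ))
    obtain ⟨s, hs, hsσ⟩ := (h2.and self_mem_nhdsWithin).exists
    rw [← ofReal_cdf]
    exact ENNReal.ofReal_le_ofReal ((monotone_cdf Q hs.le).trans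
      (cdf_le_of_sqrt_privVariance_lt hε hδ hδ1 hsσ))
  obtain ⟨u, hu, hua, hlim⟩ := exists_seq_strictMono_tendsto a
  have hU : Set.Iio a = ⋃ n, Set.Iic (u n) := by
    ext z
    simp only [Set.mem_Iio, Set.mem_iUnion, Set.mem_Iic]
    constructor
    · intro hz
      obtain ⟨n, hn⟩ := (hlim.eventually (lt_mem_nhds hz)).exists
      exact ⟨n, hn.le⟩
    · rintro ⟨n, hn⟩
      exact hn.trans_lt (hua n)
  rw [hU, (show Monotone fun n => Set.Iic (u n) from
    fun i j hij => Set.Iic_subset_Iic.2 (hu.monotone hij)).measure_iUnion]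
  exact iSup_le fun n => h1 _ (hua n)

end Real

/-! ### The Gaussian mechanism -/

section Mechanism

variable {E : Type*} [NormedAddCommGroup E] [InnerProductSpace ℝ E] [FiniteDimensional ℝ E]
  [MeasurableSpace E] [BorelSpace E]

/-- The normalized projection `⟨u, g⟩ / ‖u‖` is standard normal, and the event says that it lies
below `‖u‖ / 2 - ε / ‖u‖`. This cutoff increases with `‖u‖`, so the worst case is `‖u‖ = 1 / σ`,
where the calibration applies. -/
lemma stdGaussian_privacyLoss_le {ε δ : ℝ} (hε : 0 < ε) (hδ : 0 < δ) (hδ1 : δ < 1) {u : E}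
    (hu : Real.sqrt (privVariance ε δ) * ‖u‖ ≤ 1) :
    stdGaussian E {g | ε < ‖u‖ ^ 2 / 2 - inner ℝ u g} ≤ ENNReal.ofReal δ := by
  rcases eq_or_ne u 0 with rfl | hu0
  · have : {g : E | ε < ‖(0 : E)‖ ^ 2 / 2 - inner ℝ (0 : E) g} = ∅ := by
      ext; simp [hε.le]
    rw [this, measure_empty]; exact bot_le
  set σ := Real.sqrt (privVariance ε δ)
  have hσ : 0 < σ := sqrt_privVariance_pos hε hδ hδ1
  have hn : 0 < ‖u‖ := norm_pos_iff.2 hu0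
  refine le_trans ?_ (gaussianReal_Iio_sqrt_privVariance_le hε hδ hδ1)
  have h1 : (stdGaussian E).map (fun g => ‖u‖⁻¹ * inner ℝ u g) = gaussianReal 0 1 := by
    have h := gaussianReal_map_const_mul (μ := 0) (v := ‖u‖₊ ^ 2) ‖u‖⁻¹
    rw [← stdGaussian_map_inner, Measure.map_map (by fun_prop) (by fun_prop)] at h
    have e : (NNReal.mk (‖u‖⁻¹ ^ 2) (sq_nonneg _)) * ‖u‖₊ ^ 2 = 1 := by
      apply NNReal.coe_injective
      push_cast
      field_simp
    rw [e, mul_zero] at h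
    exact h
  rw [← h1, Measure.map_apply (by fun_prop) measurableSet_Iio]
  refine measure_mono fun g hg => ?_
  have hg' : ε < ‖u‖ ^ 2 / 2 - inner ℝ u g := hg
  show ‖u‖⁻¹ * inner ℝ u g < -σ * ε + 1 / (2 * σ)
  have a1 : ‖u‖⁻¹ * inner ℝ u g < ‖u‖⁻¹ * (‖u‖ ^ 2 / 2 - ε) := by gcongr; linarith
  have a2 : ‖u‖⁻¹ * (‖u‖ ^ 2 / 2 - ε) = ‖u‖ / 2 - ‖u‖⁻¹ * ε := by field_simp
  have a3 : ‖u‖ ≤ 1 / σ := by rw [le_div_iff₀ hσ]; linarith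
  have a4 : σ ≤ ‖u‖⁻¹ := by rw [← one_div, le_div_iff₀ hn]; linarith
  have a5 : 1 / (2 * σ) = 1 / σ / 2 := by field_simp
  rw [a5]
  nlinarith

/-- The Gaussian mechanism is private. -/
lemma stdGaussian_mechanism {ε δ : ℝ} (hε : 0 < ε) (hδ : 0 < δ) (hδ1 : δ < 1) {a b : E} {t : ℝ}
    (hab : ‖b - a‖ ≤ t) {s : Set E} (hs : MeasurableSet s) :
    stdGaussian E {g | a + (Real.sqrt (privVariance ε δ) * t) • g ∈ s} ≤
      ENNReal.ofReal (Real.exp ε) *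
        stdGaussian E {g | b + (Real.sqrt (privVariance ε δ) * t) • g ∈ s} + ENNReal.ofReal δ := by
  have hσ := sqrt_privVariance_pos hε hδ hδ1
  set σ := Real.sqrt (privVariance ε δ) with hσd
  rcases eq_or_ne t 0 with rfl | ht
  · have : b = a := by rw [← sub_eq_zero, ← norm_le_zero_iff]; exact hab
    subst this
    have h1 : 1 ≤ ENNReal.ofReal (Real.exp ε) := by
      rw [ENNReal.one_le_ofReal]; exact Real.one_le_exp hε.le
    exact le_add_right (le_mul_of_one_le_left' h1)
  have ht0 : 0 < t := ((norm_nonneg _).trans hab).lt_of_ne' ht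
  have hst : 0 < σ * t := by positivity
  -- The displacement in units of the noise: moving the center from `a` to `b` is translating `g` by
  -- `u`, and `‖u‖ ≤ 1 / σ`.
  set u : E := (σ * t)⁻¹ • (b - a) with hu
  have h1 := stdGaussian_le_translate (s := {g : E | a + (σ * t) • g ∈ s})
    (hs.preimage (by fun_prop)) u ε
  have h2 : {g : E | g + u ∈ {g : E | a + (σ * t) • g ∈ s}} = {g | b + (σ * t) • g ∈ s} := by
    ext g
    have : a + (σ * t) • (g + u) = b + (σ * t) • g := by
      rw [smul_add, hu, smul_inv_smul₀ hst.ne']; abel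
    simp only [Set.mem_ofPred_eq, this]
  rw [h2] at h1
  refine h1.trans ?_
  gcongr
  apply stdGaussian_privacyLoss_le hε hδ hδ1
  rw [hu, norm_smul, norm_inv, Real.norm_of_nonneg hst.le, ← hσd, ← mul_assoc, mul_inv,
    mul_inv_cancel_left₀ hσ.ne', inv_mul_le_iff₀ ht0, mul_one]
  exact hab

end Mechanism

/-! ### The Laplace distribution: tails and translations -/

section Laplace

lemma laplaceOne_apply_Ioi {x : ℝ} (hx : 0 ≤ x) :
    laplaceOne (Set.Ioi x) = ENNReal.ofReal (Real.exp (-x) / 2) := by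
  rw [laplaceOne, withDensity_apply _ measurableSet_Ioi,
    setLIntegral_congr_fun measurableSet_Ioi (g := fun w => ENNReal.ofReal (Real.exp (-w) / 2))
      (fun w hw => by
        dsimp only
        rw [abs_of_pos (hx.trans_lt hw)]),
    ← ofReal_integral_eq_lintegral_ofReal ((integrableOn_exp_neg_Ioi x).div_const 2)
      (ae_of_all _ fun w => by positivity), integral_div, integral_exp_neg_Ioi]

lemma laplaceOne_apply_Iic {x : ℝ} (hx : x ≤ 0) :
    laplaceOne (Set.Iic x) = ENNReal.ofReal (Real.exp x / 2) := by
  rw [laplaceOne, withDensity_apply _ measurableSet_Iic,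
    setLIntegral_congr_fun measurableSet_Iic (g := fun w => ENNReal.ofReal (Real.exp w / 2))
      (fun w hw => by
        dsimp only
        rw [abs_of_nonpos (le_trans hw hx), neg_neg]),
    ← ofReal_integral_eq_lintegral_ofReal ((integrableOn_exp_Iic x).div_const 2)
      (ae_of_all _ fun w => by positivity), integral_div, integral_exp_Iic]

instance isProbabilityMeasure_laplaceOne : IsProbabilityMeasure laplaceOne where
  measure_univ := by
    rw [← Set.Iic_union_Ioi (a := (0 : ℝ)), measure_union (by simp) measurableSet_Ioi,
      laplaceOne_apply_Iic le_rfl, laplaceOne_apply_Ioi le_rfl,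
      ← ENNReal.ofReal_add (by positivity) (by positivity)]
    norm_num

lemma laplaceOne_apply_Ici {x : ℝ} (hx : 0 ≤ x) :
    laplaceOne (Set.Ici x) = ENNReal.ofReal (Real.exp (-x) / 2) := by
  have : laplaceOne ≪ volume := withDensity_absolutelyContinuous _ _
  rw [← laplaceOne_apply_Ioi hx]
  exact measure_congr (this.ae_eq Ioi_ae_eq_Ici.symm)

/-- By the triangle inequality the ratio of translated densities is at most `exp |c|`. The form with
functions, not only events, serves to integrate conditional probabilities given the Laplace noise.
-/
lemma lintegral_laplaceOne_add_le {f : ℝ → ℝ≥0∞} (hf : Measurable f) (c : ℝ) :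
    ∫⁻ w, f (w + c) ∂laplaceOne ≤ ENNReal.ofReal (Real.exp |c|) * ∫⁻ w, f w ∂laplaceOne := by
  have hm : Measurable fun x : ℝ => ENNReal.ofReal (Real.exp (-|x|) / 2) := by fun_prop
  rw [laplaceOne, lintegral_withDensity_eq_lintegral_mul _ hm (by fun_prop),
    lintegral_withDensity_eq_lintegral_mul _ hm hf, ← lintegral_const_mul _ (hm.mul hf),
    ← lintegral_sub_right_eq_self (μ := (volume : Measure ℝ)) _ c]
  refine lintegral_mono fun w => ?_
  simp only [Pi.mul_apply, sub_add_cancel]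
  rw [← mul_assoc, ← ENNReal.ofReal_mul (by positivity)]
  gcongr
  rw [← mul_div_assoc, ← Real.exp_add]
  gcongr
  have := abs_sub_abs_le_abs_sub w (w - c)
  rw [sub_sub_cancel] at this
  linarith

end Laplace

/-! ### The smallest eigenvalue as a minimal Rayleigh quotient -/

section MinEigenvalue

variable {d : ℕ} {H : EuclideanSpace ℝ (Fin d) →L[ℝ] EuclideanSpace ℝ (Fin d)}

lemma bddBelow_eigenvalues {c : ℝ} (hc : ∀ v, c * ‖v‖ ^ 2 ≤ inner ℝ (H v) v) :
    c ∈ lowerBounds {μ : ℝ | Module.End.HasEigenvalue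
      (H : EuclideanSpace ℝ (Fin d) →ₗ[ℝ] EuclideanSpace ℝ (Fin d)) μ} := by
  rintro μ hμ
  obtain ⟨v, hv⟩ := hμ.exists_hasEigenvector
  have h1 : H v = μ • v := hv.apply_eq_smul
  have h2 := hc v
  rw [h1, real_inner_smul_left, real_inner_self_eq_norm_sq] at h2
  exact le_of_mul_le_mul_right h2 (by have := norm_pos_iff.2 hv.2; positivity)

variable (hd : 0 < d) (hH : (H : EuclideanSpace ℝ (Fin d) →ₗ[ℝ] EuclideanSpace ℝ (Fin d)).IsSymmetric)
include hd hH

lemma hasEigenvalue_iInf : Module.End.HasEigenvalue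
    (H : EuclideanSpace ℝ (Fin d) →ₗ[ℝ] EuclideanSpace ℝ (Fin d))
    (⨅ v : {v : EuclideanSpace ℝ (Fin d) // v ≠ 0}, inner ℝ (H v) (v : EuclideanSpace ℝ (Fin d)) /
      ‖(v : EuclideanSpace ℝ (Fin d))‖ ^ 2 : ℝ) := by
  have : Nonempty (Fin d) := ⟨⟨0, hd⟩⟩
  exact hH.hasEigenvalue_iInf_of_finiteDimensional

lemma le_minEigenvalue {c : ℝ} (hc : ∀ v, c * ‖v‖ ^ 2 ≤ inner ℝ (H v) v) :
    c ≤ minEigenvalue H :=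
  le_csInf ⟨_, hasEigenvalue_iInf hd hH⟩ (bddBelow_eigenvalues hc)

/-- The minimal Rayleigh quotient is itself an eigenvalue. The auxiliary bound `c` only ensures that
both infima are over sets bounded below. -/
lemma minEigenvalue_mul_le {c : ℝ} (hc : ∀ v, c * ‖v‖ ^ 2 ≤ inner ℝ (H v) v)
    (v : EuclideanSpace ℝ (Fin d)) : minEigenvalue H * ‖v‖ ^ 2 ≤ inner ℝ (H v) v := by
  rcases eq_or_ne v 0 with rfl | hv
  · simp
  have hv0 : 0 < ‖v‖ ^ 2 := by have := norm_pos_iff.2 hv; positivity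
  rw [← le_div_iff₀ hv0]
  refine (csInf_le ⟨c, bddBelow_eigenvalues hc⟩ (hasEigenvalue_iInf hd hH)).trans
    (ciInf_le (f := fun v : {v : EuclideanSpace ℝ (Fin d) // v ≠ 0} =>
      inner ℝ (H v) (v : EuclideanSpace ℝ (Fin d)) / ‖(v : EuclideanSpace ℝ (Fin d))‖ ^ 2)
      ⟨c, ?_⟩ ⟨v, hv⟩)
  rintro _ ⟨w, rfl⟩
  have : 0 < ‖(w : EuclideanSpace ℝ (Fin d))‖ := norm_pos_iff.2 w.2
  exact (le_div_iff₀ (by positivity)).2 (hc w)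

end MinEigenvalue

/-! ### Derivatives of ridge functions and neighboring samples -/

section Ridge

variable {d : ℕ}

local notation "E" => EuclideanSpace ℝ (Fin d)

lemma hasGradientAt_comp_inner {g : ℝ → ℝ} {g' : ℝ} {x θ : E}
    (hg : HasDerivAt g g' (inner ℝ θ x)) :
    HasGradientAt (fun θ : E => g (inner ℝ θ x)) (g' • x) θ := by
  rw [hasGradientAt_iff_hasFDerivAt]
  have h1 : HasFDerivAt (fun θ : E => (inner ℝ θ x : ℝ)) (innerSL ℝ x) θ := by
    simpa [real_inner_comm] using (innerSL ℝ x).hasFDerivAt (x := θ)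
  refine (hg.comp_hasFDerivAt θ h1).congr_fderiv ?_
  ext v
  simp

lemma hessian_comp_inner {g : ℝ → ℝ} (hg : ContDiff ℝ 2 g) (x θ v : E) :
    hessian (fun θ : E => g (inner ℝ θ x)) θ v =
      (deriv (deriv g) (inner ℝ θ x) * inner ℝ v x) • x := by
  have hg1 : Differentiable ℝ g := hg.differentiable (by norm_num)
  have hg2 : Differentiable ℝ (deriv g) :=
    (hg.iterate_deriv' 1 1).differentiable (by norm_num)
  have e : gradient (fun θ : E => g (inner ℝ θ x)) = fun θ => deriv g (inner ℝ θ x) • x := by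
    ext1 θ
    exact (hasGradientAt_comp_inner (hg1 _).hasDerivAt).gradient
  have h1 : HasFDerivAt (fun θ : E => (inner ℝ θ x : ℝ)) (innerSL ℝ x) θ := by
    simpa [real_inner_comm] using (innerSL ℝ x).hasFDerivAt (x := θ)
  have h2 : HasFDerivAt (fun θ : E => deriv g (inner ℝ θ x) • x) _ θ :=
    ((hg2 _).hasDerivAt.comp_hasFDerivAt θ h1).smul_const x
  rw [hessian, e, h2.fderiv]
  simp [real_inner_comm]

end Ridge

lemma Neighboring.symm {Z : Type*} {n : ℕ} {S S' : Fin n → Z} (h : Neighboring S S') :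
    Neighboring S' S := by
  obtain ⟨σ, i, h⟩ := h
  refine ⟨σ.symm, σ i, fun j hj => ?_⟩
  rw [← h _ (fun e => hj (by rw [← e, σ.apply_symm_apply])), σ.apply_symm_apply]

/-- Sums over a sample do not see the permutation. One pair of observations serves for all `f`,
hence for slopes and curvatures in every direction. -/
lemma Neighboring.exists_sum_sub {Z : Type*} {n : ℕ} {S S' : Fin n → Z} (h : Neighboring S S') :
    ∃ z z' : Z, ∀ f : Z → ℝ, ∑ j, f (S' j) - ∑ j, f (S j) = f z' - f z := by
  obtain ⟨σ, i, h⟩ := h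
  refine ⟨S i, S' (σ i), fun f => ?_⟩
  rw [← Equiv.sum_comp σ, ← Finset.sum_sub_distrib, Finset.sum_eq_single i]
  · intro j _ hj; rw [h j hj, sub_self]
  · simp

/-! ### Slopes and curvatures of the loss -/

namespace GLM

variable {α ρ : ℝ} {d : ℕ} {Y : Type*} (P : GLM α ρ d Y)

local notation "E" => EuclideanSpace ℝ (Fin d)

lemma differentiable_h (y : Y) : Differentiable ℝ fun t => P.h t y :=
  (P.qsc y).2.1.differentiable (by norm_num)

lemma contDiff_deriv_h (y : Y) : ContDiff ℝ 1 (deriv fun t => P.h t y) :=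
  (P.qsc y).2.1.iterate_deriv' 1 1

lemma differentiable_deriv_h (y : Y) : Differentiable ℝ (deriv fun t => P.h t y) :=
  (P.contDiff_deriv_h y).differentiable (by norm_num)

lemma deriv_deriv_h_nonneg (y : Y) (t : ℝ) : 0 ≤ deriv (deriv fun t => P.h t y) t := by
  have h : ConvexOn ℝ Set.univ fun t => P.h t y := (P.qsc y).1
  have hm := h.monotoneOn_deriv fun x _ => P.differentiable_h y x
  exact (monotoneOn_univ.1 hm).deriv_nonneg

lemma norm_le_radius {x : E} (hx : x ∈ P.X) : ‖x‖ ≤ P.radius := by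
  obtain ⟨R, hR⟩ := P.bounded_X.exists_norm_le
  exact le_csSup ⟨R, by rintro _ ⟨x, hx, rfl⟩; exact hR x hx⟩ ⟨x, hx, rfl⟩

lemma radius_nonneg : 0 ≤ P.radius :=
  Real.sSup_nonneg (by rintro _ ⟨x, _, rfl⟩; exact norm_nonneg _)

/-- The directional derivative of the loss. -/
def slope (z : P.X × Y) (θ v : E) : ℝ :=
  deriv (fun t => P.h t z.2) (inner ℝ θ (z.1 : E)) * inner ℝ v (z.1 : E)

/-- The second directional derivative of the loss. -/
def curv (z : P.X × Y) (θ v : E) : ℝ :=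
  deriv (deriv fun t => P.h t z.2) (inner ℝ θ (z.1 : E)) * inner ℝ v (z.1 : E) ^ 2

lemma curv_nonneg (z : P.X × Y) (θ v : E) : 0 ≤ P.curv z θ v :=
  mul_nonneg (P.deriv_deriv_h_nonneg _ _) (sq_nonneg _)

lemma inner_hessian (z : P.X × Y) (θ v w : E) :
    inner ℝ (hessian (P.loss z) θ v) w = deriv (deriv fun t => P.h t z.2) (inner ℝ θ (z.1 : E)) *
      inner ℝ v (z.1 : E) * inner ℝ w (z.1 : E) := by
  unfold loss
  rw [hessian_comp_inner (P.qsc z.2).2.1, real_inner_smul_left, real_inner_comm w]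

lemma curv_le (z : P.X × Y) (θ v : E) : P.curv z θ v ≤ P.L₁ * ‖v‖ ^ 2 := by
  have h1 := P.inner_hessian z θ v v
  have h2 := P.norm_hessian_le z.1 z.1.2 z.2 θ
  have h3 : ‖hessian (P.loss z) θ v‖ ≤ P.L₁ * ‖v‖ := (ContinuousLinearMap.le_opNorm _ _).trans
    (mul_le_mul_of_nonneg_right h2 (norm_nonneg _))
  have h4 := real_inner_le_norm (hessian (P.loss z) θ v) v
  rw [curv, sq, ← mul_assoc, ← h1]
  nlinarith [norm_nonneg v]

lemma abs_slope_le (z : P.X × Y) (θ v : E) : |P.slope z θ v| ≤ P.L₀ * ‖v‖ := by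
  have h2 := P.norm_gradient_le z.1 z.1.2 z.2 θ
  rw [(hasGradientAt_comp_inner (P.differentiable_h z.2 _).hasDerivAt).gradient, norm_smul,
    Real.norm_eq_abs] at h2
  rw [slope, abs_mul]
  calc _ ≤ |deriv (fun t => P.h t z.2) (inner ℝ θ (z.1 : E))| * (‖v‖ * ‖(z.1 : E)‖) := by
        gcongr; exact abs_real_inner_le_norm _ _
    _ = _ * ‖(z.1 : E)‖ * ‖v‖ := by ring
    _ ≤ _ := by gcongr

lemma L₀_nonneg (z : P.X × Y) : 0 ≤ P.L₀ :=
  (norm_nonneg _).trans (P.norm_gradient_le z.1 z.1.2 z.2 0)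

lemma L₁_nonneg (z : P.X × Y) : 0 ≤ P.L₁ :=
  (norm_nonneg _).trans (P.norm_hessian_le z.1 z.1.2 z.2 0)

/-- Moving the parameter by `w` moves the linear predictor by `⟨w, x⟩`, at most `r T` in absolute
value. The resulting factor is the same for all observations and so passes to the average. -/
lemma mul_curv_le_curv_add (z : P.X × Y) (θ v w : E) {T : ℝ} (hw : ‖w‖ ≤ T) :
    (1 - P.φ (P.radius * T)).toReal * P.curv z θ v ≤ P.curv z (θ + w) v := by
  have h := ((P.qsc z.2).2.2 (inner ℝ θ (z.1 : E)) (inner ℝ w (z.1 : E))).1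
  have hφ : P.φ |inner ℝ w (z.1 : E)| ≤ P.φ (P.radius * T) := by
    refine P.monotone_φ (Set.mem_Ici.2 (abs_nonneg _))
      (mul_nonneg P.radius_nonneg ((norm_nonneg _).trans hw)) ?_
    refine (abs_real_inner_le_norm _ _).trans ?_
    rw [mul_comm]
    exact mul_le_mul (P.norm_le_radius z.1.2) hw (norm_nonneg _) P.radius_nonneg
  have h1 : ENNReal.ofReal (deriv (deriv fun t => P.h t z.2) (inner ℝ θ (z.1 : E))) *
      (1 - P.φ (P.radius * T)) ≤ _ := (mul_le_mul_right (tsub_le_tsub_left hφ 1) _).trans h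
  have h2 := ENNReal.toReal_mono ENNReal.ofReal_ne_top h1
  rw [ENNReal.toReal_mul, ENNReal.toReal_ofReal (P.deriv_deriv_h_nonneg _ _),
    ENNReal.toReal_ofReal (P.deriv_deriv_h_nonneg _ _), ← inner_add_left] at h2
  rw [curv, curv]
  nlinarith [sq_nonneg (inner ℝ v (z.1 : E) : ℝ)]

variable {n : ℕ} (S : Fin n → P.X × Y)

/-- The second directional derivative of the unregularized empirical loss. -/
def empCurv (θ v : E) : ℝ := (1 / (n : ℝ)) * ∑ i, P.curv (S i) θ v

/-- The directional derivative of the regularized empirical loss. -/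
def objSlope (θ v : E) : ℝ :=
  (1 / (n : ℝ)) * ∑ i, P.slope (S i) θ v + P.lamReg * inner ℝ (θ - P.θ₀) v

lemma inner_empHessian (θ v w : E) : inner ℝ (P.empHessian S θ v) w =
    (1 / (n : ℝ)) * ∑ i, deriv (deriv fun t => P.h t (S i).2) (inner ℝ θ ((S i).1 : E)) *
      inner ℝ v ((S i).1 : E) * inner ℝ w ((S i).1 : E) := by
  simp only [empHessian, smul_apply, sum_apply,
    real_inner_smul_left, sum_inner, inner_hessian]

lemma inner_empHessian_self (θ v : E) : inner ℝ (P.empHessian S θ v) v = P.empCurv S θ v := by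
  rw [inner_empHessian, empCurv]
  simp only [curv, sq, mul_assoc]

lemma isSymmetric_empHessian (θ : E) : (P.empHessian S θ : E →ₗ[ℝ] E).IsSymmetric := fun v w => by
  have h1 := P.inner_empHessian S θ v w
  have h2 := P.inner_empHessian S θ w v
  simp only [ContinuousLinearMap.coe_coe]
  rw [real_inner_comm _ v, h1, h2]
  simp only [mul_right_comm]

lemma empCurv_nonneg (θ v : E) : 0 ≤ P.empCurv S θ v :=
  mul_nonneg (by positivity) (Finset.sum_nonneg fun i _ => P.curv_nonneg _ _ _)

lemma empCurv_le (hn : 0 < n) (θ v : E) : P.empCurv S θ v ≤ P.L₁ * ‖v‖ ^ 2 := by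
  have h := Finset.sum_le_sum fun i (_ : i ∈ Finset.univ) => P.curv_le (S i) θ v
  rw [Finset.sum_const, Finset.card_univ, Fintype.card_fin, nsmul_eq_mul] at h
  have hn' : (0 : ℝ) < n := Nat.cast_pos.2 hn
  rw [empCurv, one_div, inv_mul_le_iff₀ hn']
  exact h

lemma mul_empCurv_le_empCurv_add (θ v w : E) {T : ℝ} (hw : ‖w‖ ≤ T) :
    (1 - P.φ (P.radius * T)).toReal * P.empCurv S θ v ≤ P.empCurv S (θ + w) v := by
  rw [empCurv, empCurv, mul_left_comm, Finset.mul_sum]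
  gcongr
  exact P.mul_curv_le_curv_add _ _ _ _ hw

lemma hasDerivAt_inner_line (θ v x : E) (s : ℝ) :
    HasDerivAt (fun s : ℝ => (inner ℝ (θ + s • v) x : ℝ)) (inner ℝ v x) s := by
  have h := ((hasDerivAt_id s).mul_const (inner ℝ v x : ℝ)).const_add (inner ℝ θ x : ℝ)
  simpa [inner_add_left, real_inner_smul_left] using h

lemma hasDerivAt_objective (θ v : E) (s : ℝ) :
    HasDerivAt (fun s : ℝ => P.objective S (θ + s • v)) (P.objSlope S (θ + s • v) v) s := by
  have h1 : HasDerivAt (fun s : ℝ => ∑ i, P.loss (S i) (θ + s • v))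
      (∑ i, P.slope (S i) (θ + s • v) v) s :=
    HasDerivAt.fun_sum fun i _ => (P.differentiable_h (S i).2 _).hasDerivAt.comp s
      (hasDerivAt_inner_line θ v _ s)
  have h2 : HasDerivAt (fun s : ℝ => ‖θ + s • v - P.θ₀‖ ^ 2)
      (2 * inner ℝ (θ + s • v - P.θ₀) v) s := by
    have : HasDerivAt (fun s : ℝ => θ + s • v - P.θ₀) v s := by
      simpa using (((hasDerivAt_id s).smul_const v).const_add θ).sub_const P.θ₀
    exact this.norm_sq
  exact ((h1.const_mul (1 / (n : ℝ))).add (h2.const_mul (P.lamReg / 2))).congr_deriv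
    (by rw [objSlope]; ring)

lemma hasDerivAt_objSlope (θ v : E) (s : ℝ) :
    HasDerivAt (fun s : ℝ => P.objSlope S (θ + s • v) v)
      (P.empCurv S (θ + s • v) v + P.lamReg * ‖v‖ ^ 2) s := by
  have h1 : HasDerivAt (fun s : ℝ => ∑ i, P.slope (S i) (θ + s • v) v)
      (∑ i, P.curv (S i) (θ + s • v) v) s := by
    refine HasDerivAt.fun_sum fun i _ => ?_
    have := ((P.differentiable_deriv_h (S i).2 _).hasDerivAt.comp s
      (hasDerivAt_inner_line θ v ((S i).1 : E) s)).mul_const (inner ℝ v ((S i).1 : E) : ℝ)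
    rw [curv, sq, ← mul_assoc]
    exact this
  have h2 : HasDerivAt (fun s : ℝ => (inner ℝ (θ + s • v - P.θ₀) v : ℝ)) (‖v‖ ^ 2) s := by
    have := hasDerivAt_inner_line (θ - P.θ₀) v v s
    rw [real_inner_self_eq_norm_sq] at this
    simpa only [sub_add_eq_add_sub] using this
  exact (h1.const_mul (1 / (n : ℝ))).add (h2.const_mul P.lamReg)

lemma continuous_objective : Continuous (P.objective S) := by
  have h : ∀ i, Continuous (P.loss (S i)) := fun i =>
    (P.differentiable_h (S i).2).continuous.comp (by fun_prop)
  unfold objective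
  fun_prop

lemma monotone_objSlope (θ v : E) : Monotone fun s : ℝ => P.objSlope S (θ + s • v) v := by
  refine monotone_of_deriv_nonneg (fun s => (P.hasDerivAt_objSlope S θ v s).differentiableAt)
    fun s => ?_
  rw [(P.hasDerivAt_objSlope S θ v s).deriv]
  exact add_nonneg (P.empCurv_nonneg _ _ _) (mul_nonneg P.lamReg_nonneg (sq_nonneg _))

variable {S}

lemma IsArgmin.objSlope_eq_zero {θ : E} (h : P.IsArgmin S θ) (v : E) : P.objSlope S θ v = 0 := by
  have h1 := P.hasDerivAt_objective S θ v 0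
  have h2 : IsLocalMin (fun s : ℝ => P.objective S (θ + s • v)) 0 :=
    Filter.Eventually.of_forall fun s => by simpa using h _
  simpa using h2.hasDerivAt_eq_zero h1

lemma neighboring_objSlope {S' : Fin n → P.X × Y} (h : Neighboring S S') (θ v : E) :
    P.objSlope S θ v - 2 * P.L₀ / n * ‖v‖ ≤ P.objSlope S' θ v := by
  obtain ⟨z, z', hz⟩ := h.exists_sum_sub
  have h1 := hz fun z => P.slope z θ v
  have h2 := abs_le.1 (P.abs_slope_le z θ v)
  have h3 := abs_le.1 (P.abs_slope_le z' θ v)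
  have h4 : (1 / (n : ℝ)) * (∑ j, P.slope (S j) θ v - 2 * P.L₀ * ‖v‖) ≤
      (1 / (n : ℝ)) * ∑ j, P.slope (S' j) θ v := by gcongr; linarith
  have h5 : 2 * P.L₀ / n * ‖v‖ = (1 / (n : ℝ)) * (2 * P.L₀ * ‖v‖) := by ring
  rw [objSlope, objSlope, h5]
  linarith

/-- Only one `L₁ / n` is lost: the removed curvature is at most `L₁ ‖v‖²`, and the added one is
nonnegative. -/
lemma neighboring_empCurv {S' : Fin n → P.X × Y} (h : Neighboring S S') (θ v : E) :
    P.empCurv S θ v - P.L₁ / n * ‖v‖ ^ 2 ≤ P.empCurv S' θ v := by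
  obtain ⟨z, z', hz⟩ := h.exists_sum_sub
  have h1 := hz fun z => P.curv z θ v
  have h2 := P.curv_le z θ v
  have h3 := P.curv_nonneg z' θ v
  have h4 : (1 / (n : ℝ)) * (∑ j, P.curv (S j) θ v - P.L₁ * ‖v‖ ^ 2) ≤
      (1 / (n : ℝ)) * ∑ j, P.curv (S' j) θ v := by gcongr; linarith
  have h5 : P.L₁ / n * ‖v‖ ^ 2 = (1 / (n : ℝ)) * (P.L₁ * ‖v‖ ^ 2) := by ring
  rw [empCurv, empCurv, h5]
  linarith

end GLM

namespace GLM

variable {α ρ : ℝ} {d : ℕ} {Y : Type*} (P : GLM α ρ d Y)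

local notation "E" => EuclideanSpace ℝ (Fin d)

/-! ### Existence and stability of minimizers -/

section Stability

variable {P} {n : ℕ} {S S' : Fin n → P.X × Y}

/-- A minimizer over the compact ball is global: slopes increase along rays, so the objective does
not decrease beyond the sphere of radius `T`. -/
lemma exists_isArgmin_of_objSlope_nonneg {θ : E} {T : ℝ} (hT : 0 ≤ T)
    (h : ∀ v : E, ‖v‖ = 1 → 0 ≤ P.objSlope S (θ + T • v) v) : ∃ u, P.IsArgmin S u := by
  obtain ⟨u, -, hu⟩ := (isCompact_closedBall θ T).exists_isMinOn ⟨θ, by simpa using hT⟩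
    (P.continuous_objective S).continuousOn
  refine ⟨u, fun w => ?_⟩
  by_cases hw : ‖w - θ‖ ≤ T
  · exact hu (by simpa [dist_eq_norm] using hw)
  push Not at hw
  have hpos : 0 < ‖w - θ‖ := hT.trans_lt hw
  set v : E := ‖w - θ‖⁻¹ • (w - θ) with hv
  have hv1 : ‖v‖ = 1 := by rw [hv, norm_smul, norm_inv, norm_norm, inv_mul_cancel₀ hpos.ne']
  have hwv : w = θ + ‖w - θ‖ • v := by rw [hv, smul_inv_smul₀ hpos.ne']; abel
  have hmono : MonotoneOn (fun s : ℝ => P.objective S (θ + s • v)) (Set.Ici T) := by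
    refine monotoneOn_of_deriv_nonneg (convex_Ici T)
      (fun s _ => (P.hasDerivAt_objective S θ v s).continuousAt.continuousWithinAt)
      (fun s _ => (P.hasDerivAt_objective S θ v s).differentiableAt.differentiableWithinAt)
      fun s hs => ?_
    rw [(P.hasDerivAt_objective S θ v s).deriv]
    rw [interior_Ici] at hs
    exact (h v hv1).trans (P.monotone_objSlope S θ v (le_of_lt hs))
  have h1 : P.objective S (θ + T • v) ≤ P.objective S w := by
    conv_rhs => rw [hwv]
    exact hmono Set.self_mem_Ici hw.le hw.le
  refine le_trans (hu ?_) h1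
  simp [norm_smul, hv1, abs_of_nonneg hT]

lemma objSlope_add_le {θ v : E} {κ T : ℝ} (hT : 0 ≤ T)
    (h : ∀ s ∈ Set.Icc 0 T, κ ≤ P.empCurv S (θ + s • v) v + P.lamReg * ‖v‖ ^ 2) :
    P.objSlope S θ v + κ * T ≤ P.objSlope S (θ + T • v) v := by
  have h1 := (convex_Icc 0 T).mul_sub_le_image_sub_of_le_deriv
    (f := fun s : ℝ => P.objSlope S (θ + s • v) v) (C := κ)
    (fun s _ => (P.hasDerivAt_objSlope S θ v s).continuousAt.continuousWithinAt)
    (fun s _ => (P.hasDerivAt_objSlope S θ v s).differentiableAt.differentiableWithinAt)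
    (fun s hs => by
      rw [(P.hasDerivAt_objSlope S θ v s).deriv]
      exact h s (interior_subset hs))
    0 (by simpa using hT) T (by simpa using hT) hT
  simp only [zero_smul, add_zero, sub_zero] at h1
  linarith

/-- At `θ₀` the regularizer has no slope and the loss has unit slopes at least `-L₀`; moving out by
`L₀ / λ_reg` makes every radial slope nonnegative. -/
lemma exists_isArgmin_of_lamReg_pos (hn : 0 < n) (h : 0 < P.lamReg) : ∃ u, P.IsArgmin S u := by
  have hL := P.L₀_nonneg (S ⟨0, hn⟩)
  have hT : 0 ≤ P.L₀ / P.lamReg := by positivity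
  refine exists_isArgmin_of_objSlope_nonneg (θ := P.θ₀) hT fun v hv => ?_
  have h1 := objSlope_add_le (P := P) (S := S) (θ := P.θ₀) (v := v) (κ := P.lamReg) hT
    fun s _ => by have := P.empCurv_nonneg S (P.θ₀ + s • v) v; rw [hv]; linarith
  have h2 : -P.L₀ ≤ P.objSlope S P.θ₀ v := by
    have h3 := Finset.sum_le_sum fun i (_ : i ∈ Finset.univ) =>
      (abs_le.1 (P.abs_slope_le (S i) P.θ₀ v)).1
    rw [Finset.sum_const, Finset.card_univ, Fintype.card_fin, nsmul_eq_mul, hv, mul_one] at h3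
    have hn' : (0 : ℝ) < n := Nat.cast_pos.2 hn
    rw [objSlope, sub_self, inner_zero_left, mul_zero, add_zero, one_div, le_inv_mul_iff₀ hn']
    exact h3
  rw [mul_div_cancel₀ _ h.ne'] at h1
  linarith

/-- Stability of the minimizer: if the regularized loss of `S` is `κ`-strongly convex at distance
at most `T` from its minimizer and `κ T ≥ 2 L₀ / n`, then the regularized loss of a neighboring
sample has a minimizer, and all its minimizers are within `T`. -/
lemma IsArgmin.stable (hS : Neighboring S S') {θ : E} (hθ : P.IsArgmin S θ) {κ T : ℝ}
    (hT : 0 ≤ T) (hκ : 0 < κ) (hκT : 2 * P.L₀ / n ≤ κ * T)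
    (h : ∀ v : E, ‖v‖ = 1 → ∀ s ∈ Set.Icc 0 T, κ ≤ P.empCurv S (θ + s • v) v + P.lamReg) :
    (∃ u, P.IsArgmin S' u) ∧ ∀ u, P.IsArgmin S' u → ‖u - θ‖ ≤ T := by
  have key : ∀ v : E, ‖v‖ = 1 → 2 * P.L₀ / n ≤ P.objSlope S (θ + T • v) v := fun v hv => by
    have h1 := objSlope_add_le (P := P) (S := S) (θ := θ) (v := v) (κ := κ) hT fun s hs => by
      rw [hv, one_pow, mul_one]; exact h v hv s hs
    rw [hθ.objSlope_eq_zero] at h1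
    linarith
  refine ⟨exists_isArgmin_of_objSlope_nonneg (θ := θ) hT fun v hv => ?_, fun u hu => ?_⟩
  · have h1 := P.neighboring_objSlope hS (θ + T • v) v
    have h2 := key v hv
    rw [hv] at h1; linarith
  · by_contra! hw
    have hpos : 0 < ‖u - θ‖ := hT.trans_lt hw
    set v : E := ‖u - θ‖⁻¹ • (u - θ) with hv
    have hv1 : ‖v‖ = 1 := by rw [hv, norm_smul, norm_inv, norm_norm, inv_mul_cancel₀ hpos.ne']
    have huv : u = θ + ‖u - θ‖ • v := by rw [hv, smul_inv_smul₀ hpos.ne']; abel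
    have h1 := P.neighboring_objSlope hS u v
    rw [hu.objSlope_eq_zero, hv1, huv] at h1
    have hmono := P.monotone_objSlope S θ v
    -- The slope of `S` is at least `2 L₀ / n` at distance `T` and at most that at `u`. Being
    -- monotone, it is constant in between, so its derivative at `T` vanishes, against `κ > 0`. This
    -- covers the equality case `κ T = 2 L₀ / n`.
    have hconst : ∀ s ∈ Set.Icc T ‖u - θ‖,
        P.objSlope S (θ + s • v) v = P.objSlope S (θ + T • v) v := fun s hs => by
      refine le_antisymm ?_ (hmono hs.1)
      have h2 := hmono hs.2
      have h3 := key v hv1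
      have h1' : P.objSlope S (θ + ‖u - θ‖ • v) v - 2 * P.L₀ / n * 1 ≤ 0 := by
        simpa [add_sub_cancel_left, norm_smul, hv1] using h1
      dsimp only at h2
      linarith
    have hT' : T ∈ Set.Icc T ‖u - θ‖ := ⟨le_rfl, hw.le⟩
    have d1 := (P.hasDerivAt_objSlope S θ v T).hasDerivWithinAt (s := Set.Icc T ‖u - θ‖)
    have d2 : HasDerivWithinAt (fun s : ℝ => P.objSlope S (θ + s • v) v) 0
        (Set.Icc T ‖u - θ‖) T :=
      (hasDerivWithinAt_const T _ (P.objSlope S (θ + T • v) v)).congr hconst rfl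
    have h4 := (uniqueDiffOn_Icc hw T hT').eq_deriv _ d1 d2
    have h5 := h v hv1 T ⟨hT, le_rfl⟩
    rw [hv1] at h4
    linarith

end Stability

/-! ### The parameter change bound `t(λ)` -/

section ParamChange

variable {P} {n : ℕ} {lam : ℝ}

lemma paramChange_nonneg (hα : 0 ≤ α) (hL : 0 ≤ P.L₀) (hlam : 0 < lam) :
    0 ≤ P.paramChange n lam := by
  have hr := P.radius_nonneg
  unfold paramChange
  split_ifs with h
  · positivity
  · apply div_nonneg _ (by positivity)
    have : 0 ≤ 8 * α * P.radius * P.L₀ / (lam * n) := by positivity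
    rw [sub_nonneg, Real.sqrt_le_one]
    linarith

/-- `t` is the smaller root of this quadratic, hence left of its vertex `α r t = 1 / 2`. The
limiting formula for `α r = 0` satisfies the linear equation that remains. -/
lemma paramChange_quadratic (hn : 0 < n) (h : P.ParamChangeDefined n lam) :
    lam * (1 - α * P.radius * P.paramChange n lam) * P.paramChange n lam = 2 * P.L₀ / n ∧
      α * P.radius * P.paramChange n lam ≤ 1 / 2 := by
  obtain ⟨hlam, h⟩ := h
  have hn' : (0 : ℝ) < n := Nat.cast_pos.2 hn
  unfold paramChange
  split_ifs with h0
  · rw [h0]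
    constructor
    · field_simp; ring
    · norm_num
  · have hs := Real.sq_sqrt (sub_nonneg.2 h)
    set q := Real.sqrt (1 - 8 * α * P.radius * P.L₀ / (lam * n))
    have hq : 0 ≤ q := Real.sqrt_nonneg _
    have hα0 : α ≠ 0 := left_ne_zero_of_mul h0
    have hr0 : P.radius ≠ 0 := right_ne_zero_of_mul h0
    have e : α * P.radius * ((1 - q) / (2 * α * P.radius)) = (1 - q) / 2 := by field_simp
    rw [e]
    constructor
    · have e2 : lam * (1 - (1 - q) / 2) * ((1 - q) / (2 * α * P.radius)) =
          lam * (1 - q ^ 2) / (4 * α * P.radius) := by field_simp; ring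
      rw [e2, hs]; field_simp; ring
    · linarith

lemma paramChange_le (hα : 0 ≤ α) (hn : 0 < n) (hL : 0 ≤ P.L₀) (h : P.ParamChangeDefined n lam) :
    P.paramChange n lam ≤ 4 * P.L₀ / (lam * n) := by
  obtain ⟨h1, h2⟩ := paramChange_quadratic hn h
  have h3 := paramChange_nonneg (n := n) hα hL h.1
  have hn' : (0 : ℝ) < n := Nat.cast_pos.2 hn
  have h4 : lam * (1 / 2) * P.paramChange n lam ≤ 2 * P.L₀ / n := by
    rw [← h1]
    have := h.1
    gcongr
    linarith
  rw [le_div_iff₀ hn'] at h4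
  rw [le_div_iff₀ (mul_pos h.1 hn')]
  linarith

lemma le_paramChange (hα : 0 ≤ α) (hn : 0 < n) (hL : 0 ≤ P.L₀) (h : P.ParamChangeDefined n lam) :
    2 * P.L₀ / n ≤ lam * P.paramChange n lam := by
  obtain ⟨h1, h2⟩ := paramChange_quadratic hn h
  have h3 := paramChange_nonneg (n := n) hα hL h.1
  have := P.radius_nonneg
  have h4 : 0 ≤ lam * (α * P.radius * P.paramChange n lam) * P.paramChange n lam := by
    have := h.1; positivity
  linarith

lemma ParamChangeDefined.mono (hα : 0 ≤ α) (hL : 0 ≤ P.L₀) (h : P.ParamChangeDefined n lam)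
    {lam' : ℝ} (hle : lam ≤ lam') : P.ParamChangeDefined n lam' := by
  have := P.radius_nonneg
  rcases Nat.eq_zero_or_pos n with rfl | hn
  · exact ⟨h.1.trans_le hle, by simp⟩
  have hn' : (0 : ℝ) < n := Nat.cast_pos.2 hn
  refine ⟨h.1.trans_le hle, le_trans ?_ h.2⟩
  have := h.1
  gcongr

lemma paramChange_antitone (hα : 0 ≤ α) (hn : 0 < n) (hL : 0 ≤ P.L₀)
    (h : P.ParamChangeDefined n lam) {lam' : ℝ} (hle : lam ≤ lam') :
    P.paramChange n lam' ≤ P.paramChange n lam := by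
  have := P.radius_nonneg
  have hn' : (0 : ℝ) < n := Nat.cast_pos.2 hn
  have := h.1
  unfold paramChange
  split_ifs with h0
  · gcongr
  · gcongr

/-- The threshold puts `r t` in the range where `φ` has its linear bound: it gives `4 α r L₀ ≤ (1 -
ρ) n (ρ λ + λ_reg)`, while `t(λ + λ_reg) ≤ 4 L₀ / ((λ + λ_reg) n)`. -/
lemma LargeEnough.mul_paramChange_le (hα : 0 ≤ α) (hρ₀ : 0 < ρ) (hρ₁ : ρ < 1) (hn : 0 < n)
    (hL : 0 ≤ P.L₀) (hL1 : 0 ≤ P.L₁) (hlam : 0 ≤ lam) (h : P.LargeEnough n lam)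
    (hdef : P.ParamChangeDefined n (lam + P.lamReg)) :
    α * P.radius * P.paramChange n (lam + P.lamReg) ≤ 1 - ρ ∧
      α * P.radius * P.paramChange n (lam + P.lamReg) ≤
        4 * α * P.radius * P.L₀ / ((lam + P.lamReg) * n) := by
  have hr := P.radius_nonneg
  have hn' : (0 : ℝ) < n := Nat.cast_pos.2 hn
  have hμ := hdef.1
  have hρ' : 0 < 1 - ρ := by linarith
  have h1 : α * P.radius * P.paramChange n (lam + P.lamReg) ≤
      4 * α * P.radius * P.L₀ / ((lam + P.lamReg) * n) :=
    (mul_le_mul_of_nonneg_left (paramChange_le hα hn hL hdef) (by positivity)).trans_eq (by ring)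
  refine ⟨h1.trans ?_, h1⟩
  rw [div_le_iff₀ (by positivity)]
  have h2 : 4 * P.L₀ * α * P.radius / (ρ * (1 - ρ) * n) ≤ lam + P.lamReg / ρ := by
    have : 0 ≤ P.L₁ / (ρ * n) := by positivity
    have := h
    unfold LargeEnough at this
    linarith
  rw [div_le_iff₀ (by positivity)] at h2
  have h3 : (lam + P.lamReg / ρ) * (ρ * (1 - ρ) * n) = (ρ * lam + P.lamReg) * ((1 - ρ) * n) := by
    field_simp
  rw [h3] at h2
  have h4 : (ρ * lam + P.lamReg) * ((1 - ρ) * n) ≤ (lam + P.lamReg) * ((1 - ρ) * n) := by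
    gcongr; nlinarith
  linarith

lemma one_sub_le_toReal {T : ℝ} (hα : 0 ≤ α) (hT : 0 ≤ T) (h : α * P.radius * T ≤ 1 - ρ) :
    1 - α * P.radius * T ≤ (1 - P.φ (P.radius * T)).toReal := by
  have hr := P.radius_nonneg
  have h1 := P.φ_le (P.radius * T) (by positivity) (by rwa [← mul_assoc])
  rw [← mul_assoc] at h1
  have h2 : ENNReal.ofReal (1 - α * P.radius * T) ≤ 1 - P.φ (P.radius * T) := by
    rw [ENNReal.ofReal_sub _ (by positivity), ENNReal.ofReal_one]
    exact tsub_le_tsub_left h1 1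
  exact (ENNReal.ofReal_le_iff_le_toReal (by simp)).1 h2

lemma toReal_one_sub_le_one (x : ℝ≥0∞) : (1 - x).toReal ≤ 1 := by
  have := ENNReal.toReal_mono ENNReal.one_ne_top (tsub_le_self : 1 - x ≤ 1)
  simpa using this

end ParamChange

/-! ### Stability of the minimizer and of its smallest eigenvalue -/

section LamMin

variable {P} {n : ℕ} {S S' : Fin n → P.X × Y} {θ : (Fin n → P.X × Y) → EuclideanSpace ℝ (Fin d)}

lemma lamMin_eq (h : ∃ v, P.IsArgmin S v) :
    P.lamMin θ S = minEigenvalue (P.empHessian S (θ S)) := if_pos h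

lemma lamMin_mul_le (hd : 0 < d) (h : ∃ v, P.IsArgmin S v) (v : E) :
    P.lamMin θ S * ‖v‖ ^ 2 ≤ P.empCurv S (θ S) v := by
  rw [lamMin_eq h, ← inner_empHessian_self]
  refine minEigenvalue_mul_le hd (P.isSymmetric_empHessian S _) (c := 0) (fun w => ?_) v
  rw [inner_empHessian_self, zero_mul]
  exact P.empCurv_nonneg _ _ _

lemma le_lamMin (hd : 0 < d) (h : ∃ v, P.IsArgmin S v) {c : ℝ}
    (hc : ∀ v, c * ‖v‖ ^ 2 ≤ P.empCurv S (θ S) v) : c ≤ P.lamMin θ S := by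
  rw [lamMin_eq h]
  exact le_minEigenvalue hd (P.isSymmetric_empHessian S _) fun v => by
    rw [inner_empHessian_self]; exact hc v

lemma lamMin_nonneg (hd : 0 < d) : 0 ≤ P.lamMin θ S := by
  by_cases h : ∃ v, P.IsArgmin S v
  · exact le_lamMin hd h fun v => by rw [zero_mul]; exact P.empCurv_nonneg _ _ _
  · rw [lamMin, if_neg h]

lemma lamMin_le (hd : 0 < d) (hn : 0 < n) : P.lamMin θ S ≤ P.L₁ := by
  by_cases h : ∃ v, P.IsArgmin S v
  · have h1 := (lamMin_mul_le (θ := θ) hd h (EuclideanSpace.single ⟨0, hd⟩ 1)).trans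
      (P.empCurv_le S hn _ _)
    simpa using h1
  · rw [lamMin, if_neg h]; exact P.L₁_nonneg (S ⟨0, hn⟩)

/-- Under the conditions of the recursion, the minimizer moves by at most `t(λ_min + λ_reg)`. -/
lemma stable_of_largeEnough (hα : 0 ≤ α) (hρ₀ : 0 < ρ) (hρ₁ : ρ < 1) (hd : 0 < d) (hn : 0 < n)
    (hθ : P.IsEstimator θ) (hS : Neighboring S S') (hex : ∃ v, P.IsArgmin S v)
    (hle : P.LargeEnough n (P.lamMin θ S))
    (hdef : P.ParamChangeDefined n (P.lamMin θ S + P.lamReg)) :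
    (∃ u, P.IsArgmin S' u) ∧
      ∀ u, P.IsArgmin S' u → ‖u - θ S‖ ≤ P.paramChange n (P.lamMin θ S + P.lamReg) := by
  have hL := P.L₀_nonneg (S ⟨0, hn⟩)
  have hlam : 0 ≤ P.lamMin θ S := lamMin_nonneg hd
  have h1 := (hle.mul_paramChange_le hα hρ₀ hρ₁ hn hL (P.L₁_nonneg (S ⟨0, hn⟩)) hlam hdef).1
  obtain ⟨h2, h3⟩ := paramChange_quadratic hn hdef
  have hT := paramChange_nonneg (n := n) hα hL hdef.1
  set T := P.paramChange n (P.lamMin θ S + P.lamReg)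
  have h0 : 0 ≤ α * P.radius * T := by have := P.radius_nonneg; positivity
  -- With this `κ` the quadratic equation for `T` is exactly `κ T = 2 L₀ / n`. The regularization
  -- needs no self-concordance factor, so applying it there only weakens the curvature bound.
  refine (hθ S hex).stable hS (κ := (P.lamMin θ S + P.lamReg) * (1 - α * P.radius * T)) hT
    (mul_pos hdef.1 (by linarith)) h2.ge fun v hv s hs => ?_
  have h4 := P.mul_empCurv_le_empCurv_add S (θ S) v (s • v) (T := T) (by
    rw [norm_smul, hv, mul_one, Real.norm_of_nonneg hs.1]; exact hs.2)
  have h5 := one_sub_le_toReal hα hT h1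
  have h6 := lamMin_mul_le (θ := θ) hd hex v
  rw [hv, one_pow, mul_one] at h6
  have h7 := mul_le_mul h5 h6 hlam ENNReal.toReal_nonneg
  have h8 := mul_nonneg P.lamReg_nonneg h0
  linarith

/-- Regularization alone makes the minimizer stable. -/
lemma stable_of_lamReg (hα : 0 ≤ α) (hn : 0 < n) (hθ : P.IsEstimator θ) (hS : Neighboring S S')
    (hdef : P.ParamChangeDefined n P.lamReg) :
    (∃ u, P.IsArgmin S' u) ∧ ∀ u, P.IsArgmin S' u → ‖u - θ S‖ ≤ P.paramChange n P.lamReg := by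
  have hL := P.L₀_nonneg (S ⟨0, hn⟩)
  refine (hθ S (exists_isArgmin_of_lamReg_pos hn hdef.1)).stable hS (κ := P.lamReg)
    (paramChange_nonneg hα hL hdef.1) hdef.1 (le_paramChange hα hn hL hdef) fun v _ s _ => ?_
  have := P.empCurv_nonneg S (θ S + s • v) v
  linarith

/-- The recursion is a lower bound for the smallest eigenvalue of a neighboring sample. -/
lemma recursion_lamMin_le (hα : 0 ≤ α) (hρ₀ : 0 < ρ) (hρ₁ : ρ < 1) (hd : 0 < d) (hn : 0 < n)
    (hθ : P.IsEstimator θ) (hS : Neighboring S S') :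
    P.recursion n (P.lamMin θ S) ≤ P.lamMin θ S' := by
  unfold recursion
  split_ifs with h
  swap
  · exact lamMin_nonneg hd
  obtain ⟨hle, hdef⟩ := h
  refine max_le ?_ (lamMin_nonneg hd)
  by_cases hex : ∃ v, P.IsArgmin S v
  · obtain ⟨h1, h2⟩ := stable_of_largeEnough hα hρ₀ hρ₁ hd hn hθ hS hex hle hdef
    have h3 := h2 _ (hθ S' h1)
    refine le_lamMin hd h1 fun v => ?_
    have h4 := P.mul_empCurv_le_empCurv_add S (θ S) v _ h3
    rw [add_sub_cancel] at h4
    have h5 := P.neighboring_empCurv hS (θ S') v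
    have h6 := mul_le_mul_of_nonneg_left (lamMin_mul_le (θ := θ) hd hex v)
      (ENNReal.toReal_nonneg
        (a := 1 - P.φ (P.radius * P.paramChange n (P.lamMin θ S + P.lamReg))))
    rw [sub_mul]
    linarith
  · have h1 : P.lamMin θ S = 0 := by rw [lamMin, if_neg hex]
    have h2 : 0 ≤ P.L₁ / n := div_nonneg (P.L₁_nonneg (S ⟨0, hn⟩)) (Nat.cast_nonneg _)
    have h3 : 0 ≤ P.lamMin θ S' := lamMin_nonneg hd
    rw [h1, zero_mul]; linarith

end LamMin

end GLM

namespace GLM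

variable {α ρ : ℝ} {d : ℕ} {Y : Type*} {P : GLM α ρ d Y} {n : ℕ}

/-! ### Monotonicity, decay and inversion of the recursion -/

section Recursion

lemma recursion_nonneg (x : ℝ) : 0 ≤ P.recursion n x := by
  unfold recursion
  split_ifs
  · exact le_max_right _ _
  · exact le_rfl

lemma recursion_le {x : ℝ} (hx : 0 ≤ x) : P.recursion n x ≤ max (x - P.L₁ / n) 0 := by
  unfold recursion
  split_ifs
  · gcongr
    exact mul_le_of_le_one_right hx (toReal_one_sub_le_one _)
  · exact le_max_right _ _

/-- Both conditions of the recursion are upward closed, and a larger argument gives a smaller `t`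
and hence a smaller self-concordance loss. -/
lemma recursion_mono (hα : 0 ≤ α) (hn : 0 < n) (hL : 0 ≤ P.L₀) {x y : ℝ} (hx : 0 ≤ x)
    (hxy : x ≤ y) : P.recursion n x ≤ P.recursion n y := by
  by_cases h : P.LargeEnough n x ∧ P.ParamChangeDefined n (x + P.lamReg)
  · have hd : P.ParamChangeDefined n (y + P.lamReg) := h.2.mono hα hL (by linarith)
    have hle : P.LargeEnough n y := by
      have := h.1
      unfold LargeEnough at this ⊢
      linarith
    rw [recursion, if_pos h, recursion, if_pos ⟨hle, hd⟩]
    have hr := P.radius_nonneg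
    have h1 : P.paramChange n (y + P.lamReg) ≤ P.paramChange n (x + P.lamReg) :=
      paramChange_antitone hα hn hL h.2 (by linarith)
    have h2 := P.monotone_φ
      (Set.mem_Ici.2 (mul_nonneg hr (paramChange_nonneg (n := n) hα hL hd.1)))
      (Set.mem_Ici.2 (mul_nonneg hr (paramChange_nonneg (n := n) hα hL h.2.1)))
      (mul_le_mul_of_nonneg_left h1 hr)
    have h3 := ENNReal.toReal_mono (by simp) (tsub_le_tsub_left h2 1)
    gcongr
    exact hx.trans hxy
  · rw [recursion, if_neg h]; exact recursion_nonneg y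

/-- The multiplicative loss is at most an additive constant: `x α r t ≤ 4 α r L₀ / n`, since `t` is
of order `1 / (x + λ_reg)`. -/
lemma sub_le_recursion (hα : 0 ≤ α) (hρ₀ : 0 < ρ) (hρ₁ : ρ < 1) (hn : 0 < n) (hL : 0 ≤ P.L₀)
    (hL1 : 0 ≤ P.L₁) {x : ℝ} (hx : 0 ≤ x) (hle : P.LargeEnough n x)
    (hdef : P.ParamChangeDefined n (x + P.lamReg)) :
    x - (4 * α * P.radius * P.L₀ + P.L₁) / n ≤ P.recursion n x := by
  rw [recursion, if_pos ⟨hle, hdef⟩]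
  refine le_trans ?_ (le_max_left _ _)
  have hr := P.radius_nonneg
  have hn' : (0 : ℝ) < n := Nat.cast_pos.2 hn
  obtain ⟨h1, h2⟩ := hle.mul_paramChange_le hα hρ₀ hρ₁ hn hL hL1 hx hdef
  have h3 := mul_le_mul_of_nonneg_left
    (one_sub_le_toReal hα (paramChange_nonneg (n := n) hα hL hdef.1) h1) hx
  have h4 := mul_le_mul_of_nonneg_left h2 hx
  have h5 : x * (4 * α * P.radius * P.L₀ / ((x + P.lamReg) * n)) ≤
      4 * α * P.radius * P.L₀ / n := by
    have h6 : x / (x + P.lamReg) ≤ 1 := by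
      rw [div_le_one hdef.1]; linarith [P.lamReg_nonneg]
    calc _ = x / (x + P.lamReg) * (4 * α * P.radius * P.L₀ / n) := by
          have := hdef.1.ne'; field_simp
      _ ≤ _ := mul_le_of_le_one_left (by positivity) h6
  rw [add_div]
  linarith

lemma iterate_recursion_nonneg {x : ℝ} (hx : 0 ≤ x) (m : ℕ) : 0 ≤ (P.recursion n)^[m] x := by
  cases m with
  | zero => exact hx
  | succ m => rw [Function.iterate_succ_apply']; exact recursion_nonneg _

lemma iterate_recursion_mono (hα : 0 ≤ α) (hn : 0 < n) (hL : 0 ≤ P.L₀) {x y : ℝ} (hx : 0 ≤ x)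
    (hxy : x ≤ y) (m : ℕ) : (P.recursion n)^[m] x ≤ (P.recursion n)^[m] y := by
  induction m with
  | zero => exact hxy
  | succ m ih =>
    rw [Function.iterate_succ_apply', Function.iterate_succ_apply']
    exact recursion_mono hα hn hL (iterate_recursion_nonneg hx m) ih

lemma iterate_recursion_zero (hL1 : 0 ≤ P.L₁) (m : ℕ) : (P.recursion n)^[m] 0 = 0 := by
  have h : P.recursion n 0 = 0 := by
    refine le_antisymm ((recursion_le le_rfl).trans (max_le ?_ le_rfl)) (recursion_nonneg 0)
    have : 0 ≤ P.L₁ / n := by positivity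
    linarith
  exact Function.iterate_fixed h m

lemma iterate_recursion_eq_zero_of_le (hL1 : 0 ≤ P.L₁) {x : ℝ} {m k : ℕ}
    (h : (P.recursion n)^[m] x = 0) (hmk : m ≤ k) : (P.recursion n)^[k] x = 0 := by
  obtain ⟨j, rfl⟩ := Nat.exists_eq_add_of_le' hmk
  rw [Function.iterate_add_apply, h, iterate_recursion_zero hL1]

lemma iterate_recursion_le (hL1 : 0 ≤ P.L₁) {x : ℝ} (hx : 0 ≤ x) (m : ℕ) :
    (P.recursion n)^[m] x ≤ max (x - m * (P.L₁ / n)) 0 := by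
  have h0 : 0 ≤ P.L₁ / n := by positivity
  induction m with
  | zero => simp
  | succ m ih =>
    rw [Function.iterate_succ_apply']
    refine (recursion_le (iterate_recursion_nonneg hx m)).trans (max_le ?_ (le_max_right _ _))
    push_cast
    rcases le_total (x - m * (P.L₁ / n)) 0 with h | h
    · rw [max_eq_right h] at ih
      exact le_max_of_le_right (by linarith)
    · rw [max_eq_left h] at ih
      exact le_max_of_le_left (by linarith)

lemma sub_le_iterate_recursion (hα : 0 ≤ α) (hρ₀ : 0 < ρ) (hρ₁ : ρ < 1) (hn : 0 < n)
    (hL : 0 ≤ P.L₀) (hL1 : 0 ≤ P.L₁) {B x : ℝ} (hx : 0 ≤ x)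
    (hB : ∀ y, 0 ≤ y → B ≤ y → P.LargeEnough n y ∧ P.ParamChangeDefined n (y + P.lamReg))
    {m : ℕ} (h : B ≤ x - m * ((4 * α * P.radius * P.L₀ + P.L₁) / n)) :
    x - m * ((4 * α * P.radius * P.L₀ + P.L₁) / n) ≤ (P.recursion n)^[m] x := by
  have hr := P.radius_nonneg
  have h0 : 0 ≤ (4 * α * P.radius * P.L₀ + P.L₁) / n := by positivity
  induction m with
  | zero => simp
  | succ m ih =>
    push_cast at h ⊢
    have h1 := ih (by linarith)
    have h2 := iterate_recursion_nonneg (P := P) (n := n) hx m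
    obtain ⟨h3, h4⟩ := hB _ h2 (by linarith)
    rw [Function.iterate_succ_apply']
    have := sub_le_recursion hα hρ₀ hρ₁ hn hL hL1 h2 h3 h4
    linarith

/-- The eigenvalue lower bound `sup {λ ≥ 0 | R^m(λ) = 0}` released for the count `m`. -/
def lamBound (P : GLM α ρ d Y) (n m : ℕ) : ℝ :=
  sSup {lam : ℝ | 0 ≤ lam ∧ (P.recursion n)^[m] lam = 0}

/-- Needed because `sSup` of an unbounded set of reals is `0`. From a large starting point, `m`
steps of bounded loss cannot reach zero. -/
lemma bddAbove_iterate_recursion_eq_zero (hα : 0 ≤ α) (hρ₀ : 0 < ρ) (hρ₁ : ρ < 1) (hn : 0 < n)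
    (hL : 0 ≤ P.L₀) (hL1 : 0 ≤ P.L₁) (m : ℕ) :
    BddAbove {lam : ℝ | 0 ≤ lam ∧ (P.recursion n)^[m] lam = 0} := by
  have hr := P.radius_nonneg
  have hn' : (0 : ℝ) < n := Nat.cast_pos.2 hn
  have hρ' : 0 < 1 - ρ := by linarith
  have hreg := P.lamReg_nonneg
  set τ := 4 * P.L₀ * α * P.radius / (ρ * (1 - ρ) * n) + P.L₁ / (ρ * n) with hτ
  set u := 8 * α * P.radius * P.L₀ / n with hu
  have hτ0 : 0 ≤ τ := by positivity
  have hu0 : 0 ≤ u := by positivity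
  -- The summand `1` makes the threshold positive, so an iterate above it is nonzero.
  have hB : ∀ y, 0 ≤ y → τ + u + 1 ≤ y →
      P.LargeEnough n y ∧ P.ParamChangeDefined n (y + P.lamReg) := fun y hy h => by
    have hpos : 0 < y + P.lamReg := by linarith
    refine ⟨?_, hpos, ?_⟩
    · have : 0 ≤ P.lamReg / ρ := by positivity
      unfold LargeEnough
      linarith
    · rw [div_le_one (by positivity), ← div_le_iff₀ hn']
      linarith
  refine ⟨τ + u + 1 + m * ((4 * α * P.radius * P.L₀ + P.L₁) / n), fun x ⟨hx, h0⟩ => ?_⟩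
  by_contra! hlt
  have := sub_le_iterate_recursion hα hρ₀ hρ₁ hn hL hL1 hx hB (m := m) (by linarith)
  linarith

lemma lamBound_zero : P.lamBound n 0 = 0 := by
  have : {lam : ℝ | 0 ≤ lam ∧ (P.recursion n)^[0] lam = 0} = {0} := by
    ext x
    simp only [Function.iterate_zero, id_eq, Set.mem_ofPred_eq, Set.mem_singleton_iff]
    exact ⟨fun h => h.2, fun h => ⟨h.ge, h⟩⟩
  rw [lamBound, this, csSup_singleton]

lemma lamBound_nonneg (m : ℕ) : 0 ≤ P.lamBound n m := Real.sSup_nonneg fun _ h => h.1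

/-- Below the threshold one step already returns zero. For `m > 0` all such nonnegative values
belong to the set, so its supremum cannot stay below the threshold. -/
lemma largeEnough_lamBound (hα : 0 ≤ α) (hρ₀ : 0 < ρ) (hρ₁ : ρ < 1) (hn : 0 < n)
    (hL : 0 ≤ P.L₀) (hL1 : 0 ≤ P.L₁) {m : ℕ} (hm : 0 < m) :
    P.LargeEnough n (P.lamBound n m) := by
  by_contra h
  set τ := 4 * P.L₀ * α * P.radius / (ρ * (1 - ρ) * n) + P.L₁ / (ρ * n)
  have h1 : P.lamBound n m + P.lamReg / ρ < τ := not_le.1 h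
  obtain ⟨y, hy1, hy2⟩ := exists_between (lt_sub_iff_add_lt.2 h1)
  have hy0 : 0 ≤ y := (lamBound_nonneg m).trans hy1.le
  have hR : P.recursion n y = 0 := by
    rw [recursion, if_neg]
    rintro ⟨h2, -⟩
    have h2' : τ ≤ y + P.lamReg / ρ := h2
    linarith
  have hmem : y ∈ {lam : ℝ | 0 ≤ lam ∧ (P.recursion n)^[m] lam = 0} :=
    ⟨hy0, iterate_recursion_eq_zero_of_le hL1 (m := 1) hR hm⟩
  have := le_csSup (bddAbove_iterate_recursion_eq_zero hα hρ₀ hρ₁ hn hL hL1 m) hmem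
  exact absurd hy1 (not_lt.2 this)

end Recursion

/-! ### The iteration count: sensitivity and inversion -/

section StepCount

variable {S S' : Fin n → P.X × Y} {θ : (Fin n → P.X × Y) → EuclideanSpace ℝ (Fin d)}

/-- The infimum is attained because some `N` works: each step removes at least `L₁ / n` until zero,
and `λ_min ≤ L₁`, so `n` steps suffice. -/
lemma iterate_stepCount (hd : 0 < d) (hn : 0 < n) :
    (P.recursion n)^[P.stepCount θ S] (P.lamMin θ S) = 0 := by
  have hL1 := P.L₁_nonneg (S ⟨0, hn⟩)
  have hlam : 0 ≤ P.lamMin θ S := lamMin_nonneg hd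
  have hn' : (0 : ℝ) < n := Nat.cast_pos.2 hn
  refine Nat.sInf_mem (s := {N : ℕ | (P.recursion n)^[N] (P.lamMin θ S) = 0}) ⟨n, ?_⟩
  refine le_antisymm ((iterate_recursion_le hL1 hlam n).trans (max_le ?_ le_rfl))
    (iterate_recursion_nonneg hlam n)
  rw [mul_div_cancel₀ _ hn'.ne']
  linarith [lamMin_le (P := P) (S := S) (θ := θ) hd hn]

lemma stepCount_le {N : ℕ} (h : (P.recursion n)^[N] (P.lamMin θ S) = 0) :
    P.stepCount θ S ≤ N := Nat.sInf_le h

/-- One step from `λ_min(S)` lands at or below `λ_min(S')`, after which monotonicity lets the count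
of `S'` finish. -/
lemma stepCount_le_succ (hα : 0 ≤ α) (hρ₀ : 0 < ρ) (hρ₁ : ρ < 1) (hd : 0 < d) (hn : 0 < n)
    (hθ : P.IsEstimator θ) (hS : Neighboring S S') : P.stepCount θ S ≤ P.stepCount θ S' + 1 := by
  refine stepCount_le ?_
  rw [Function.iterate_succ_apply]
  refine le_antisymm ?_ (iterate_recursion_nonneg (recursion_nonneg _) _)
  rw [← iterate_stepCount (P := P) (S := S') (θ := θ) hd hn]
  exact iterate_recursion_mono hα hn (P.L₀_nonneg (S ⟨0, hn⟩)) (recursion_nonneg _)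
    (recursion_lamMin_le hα hρ₀ hρ₁ hd hn hθ hS) _

lemma abs_stepCount_sub_le (hα : 0 ≤ α) (hρ₀ : 0 < ρ) (hρ₁ : ρ < 1) (hd : 0 < d) (hn : 0 < n)
    (hθ : P.IsEstimator θ) (hS : Neighboring S S') :
    |(P.stepCount θ S : ℝ) - P.stepCount θ S'| ≤ 1 := by
  have h1 : (P.stepCount θ S : ℝ) ≤ P.stepCount θ S' + 1 := by
    exact_mod_cast stepCount_le_succ hα hρ₀ hρ₁ hd hn hθ hS
  have h2 : (P.stepCount θ S' : ℝ) ≤ P.stepCount θ S + 1 := by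
    exact_mod_cast stepCount_le_succ hα hρ₀ hρ₁ hd hn hθ hS.symm
  rw [abs_le]; constructor <;> linarith

/-- A point above `λ_min` killed in `m` steps would, by monotonicity, force `λ_min` to be killed in
`m` steps too. -/
lemma lamBound_le_lamMin (hα : 0 ≤ α) (hd : 0 < d) (hn : 0 < n) {m : ℕ}
    (hm : m < P.stepCount θ S) : P.lamBound n m ≤ P.lamMin θ S := by
  refine csSup_le ⟨0, le_rfl, iterate_recursion_zero (P.L₁_nonneg (S ⟨0, hn⟩)) m⟩
    fun x ⟨hx, h0⟩ => ?_
  by_contra! hlt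
  have hlam : 0 ≤ P.lamMin θ S := lamMin_nonneg hd
  have h1 := iterate_recursion_mono hα hn (P.L₀_nonneg (S ⟨0, hn⟩)) hlam hlt.le m
  rw [h0] at h1
  exact absurd (stepCount_le (le_antisymm h1 (iterate_recursion_nonneg hlam m))) (not_le.2 hm)

/-- If the count does not overshoot, the released bound controls the change of the minimizer. -/
lemma norm_sub_le_paramChange_lamBound (hα : 0 ≤ α) (hρ₀ : 0 < ρ) (hρ₁ : ρ < 1) (hd : 0 < d)
    (hn : 0 < n) (hθ : P.IsEstimator θ) (hS : Neighboring S S') {m : ℕ}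
    (hm : m = 0 ∨ m < P.stepCount θ S)
    (hdef : P.ParamChangeDefined n (P.lamBound n m + P.lamReg)) :
    ‖θ S' - θ S‖ ≤ P.paramChange n (P.lamBound n m + P.lamReg) := by
  have hL := P.L₀_nonneg (S ⟨0, hn⟩)
  -- At `m = 0` the bound is `0` and the threshold condition may fail, so stability comes from
  -- regularization alone.
  rcases Nat.eq_zero_or_pos m with rfl | hm0
  · rw [lamBound_zero, zero_add] at hdef ⊢
    obtain ⟨h1, h2⟩ := stable_of_lamReg hα hn hθ hS hdef
    exact h2 _ (hθ S' h1)
  · have hm' := hm.resolve_left hm0.ne'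
    have hle : P.lamBound n m ≤ P.lamMin θ S := lamBound_le_lamMin hα hd hn hm'
    -- Without a minimizer `λ_min` is `0` by convention, so the count is `0`, which leaves no room
    -- for `m` below it.
    have hex : ∃ v, P.IsArgmin S v := by
      by_contra hex
      have h0 : P.lamMin θ S = 0 := by rw [lamMin, if_neg hex]
      have := stepCount_le (P := P) (S := S) (θ := θ) (N := 0) h0
      omega
    have hlarge : P.LargeEnough n (P.lamMin θ S) := by
      have := largeEnough_lamBound hα hρ₀ hρ₁ hn hL (P.L₁_nonneg (S ⟨0, hn⟩)) hm0
      unfold LargeEnough at this ⊢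
      linarith
    obtain ⟨h1, h2⟩ := stable_of_largeEnough hα hρ₀ hρ₁ hd hn hθ hS hex hlarge
      (hdef.mono hα hL (by linarith))
    exact (h2 _ (hθ S' h1)).trans (paramChange_antitone hα hn hL hdef (by linarith))

/-- If the count does not undershoot by more than `J`, the released bound is accurate. -/
lemma half_le_lamBound_add (hα : 0 ≤ α) (hρ₀ : 0 < ρ) (hρ₁ : ρ < 1) (hd : 0 < d) (hn : 0 < n)
    {m : ℕ} {J : ℝ} (hJ : 0 ≤ J) (hm : (P.stepCount θ S : ℝ) ≤ m + J)
    (hB : ∀ y, 0 ≤ y → (P.lamMin θ S + P.lamReg) / 2 - P.lamReg ≤ y →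
      P.LargeEnough n y ∧ P.ParamChangeDefined n (y + P.lamReg))
    (hJb : J * ((4 * α * P.radius * P.L₀ + P.L₁) / n) ≤ (P.lamMin θ S + P.lamReg) / 2) :
    (P.lamMin θ S + P.lamReg) / 2 ≤ P.lamBound n m + P.lamReg := by
  have hL := P.L₀_nonneg (S ⟨0, hn⟩)
  have hL1 := P.L₁_nonneg (S ⟨0, hn⟩)
  have hr := P.radius_nonneg
  have hlam : 0 ≤ P.lamMin θ S := lamMin_nonneg hd
  have h0 : 0 ≤ (4 * α * P.radius * P.L₀ + P.L₁) / n := by positivity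
  set j := P.stepCount θ S - m with hj
  have hjJ : (j : ℝ) ≤ J := by
    rcases le_total (P.stepCount θ S) m with h | h
    · rw [hj, Nat.sub_eq_zero_of_le h]; simpa using hJ
    · rw [hj, Nat.cast_sub h]; linarith
  have h1 := mul_le_mul_of_nonneg_right hjJ h0
  have h2 := sub_le_iterate_recursion hα hρ₀ hρ₁ hn hL hL1 hlam hB (m := j) (by linarith)
  -- After `j` steps from `λ_min`, at most `m` more reach zero; this iterate is thus a competitor in
  -- the supremum.
  have hmem : (P.recursion n)^[j] (P.lamMin θ S) ∈
      {lam : ℝ | 0 ≤ lam ∧ (P.recursion n)^[m] lam = 0} := by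
    refine ⟨iterate_recursion_nonneg hlam j, ?_⟩
    rw [← Function.iterate_add_apply]
    exact iterate_recursion_eq_zero_of_le hL1 (iterate_stepCount hd hn) (by omega)
  have h3 := le_csSup (bddAbove_iterate_recursion_eq_zero hα hρ₀ hρ₁ hn hL hL1 m) hmem
  have h4 : (P.recursion n)^[j] (P.lamMin θ S) ≤ P.lamBound n m := h3
  linarith

end StepCount

end GLM

/-! ### Privacy of the release -/

instance isProbabilityMeasure_noiseLaw (d : ℕ) : IsProbabilityMeasure (noiseLaw d) := by
  unfold noiseLaw; infer_instance

/-- The count of iterations `⌊[a - (1 / ε) log (1 / (2 δ))]₊⌋`. -/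
def privCount (ε δ a : ℝ) : ℕ := ⌊max (a - (1 / ε) * Real.log (1 / (2 * δ))) 0⌋₊

lemma measurable_privCount (ε δ : ℝ) : Measurable (privCount ε δ) := by
  unfold privCount; fun_prop

/-- Below this noise level the count does not overshoot. The comparison must be strict, since `N`
steps already annihilate `λ_min`; the alternative `0` covers truncation. -/
lemma privCount_lt {ε δ w : ℝ} (hε : 0 < ε) (hw : w < Real.log (1 / (2 * δ))) (N : ℕ) :
    privCount ε δ (N + (1 / ε) * w) = 0 ∨ privCount ε δ (N + (1 / ε) * w) < N := by
  have h1 : (1 / ε) * w < (1 / ε) * Real.log (1 / (2 * δ)) := by gcongr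
  rcases Nat.eq_zero_or_pos N with rfl | hN
  · left
    rw [privCount, max_eq_right (by push_cast; linarith), Nat.floor_zero]
  · right
    rw [privCount, Nat.floor_lt (le_max_right _ _)]
    exact max_lt (by linarith) (by exact_mod_cast hN)

namespace GLM

variable {α ρ : ℝ} {d : ℕ} {Y : Type*} (P : GLM α ρ d Y) {n : ℕ}
  {S S' : Fin n → P.X × Y} {θ : (Fin n → P.X × Y) → EuclideanSpace ℝ (Fin d)}

local notation "E" => EuclideanSpace ℝ (Fin d)

open Classical in
/-- The output of the release around `a`, given the count `m` and the Gaussian vector `g`. -/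
def perturb (n : ℕ) (ε δ : ℝ) (a : E) (m : ℕ) (g : E) : E ⊕ Unit :=
  if P.ParamChangeDefined n (P.lamBound n m + P.lamReg) then
    Sum.inl (a + (Real.sqrt (privVariance ε δ) *
      P.paramChange n (P.lamBound n m + P.lamReg)) • g)
  else Sum.inr ()

lemma release_eq (ε δ : ℝ) (S : Fin n → P.X × Y) (ω : ℝ × E) : P.release θ ε δ S ω =
    P.perturb n ε δ (θ S) (privCount ε δ (P.stepCount θ S + (1 / ε) * ω.1)) ω.2 := rfl

lemma measurable_perturb (n : ℕ) (ε δ : ℝ) (a : E) (m : ℕ) :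
    Measurable (P.perturb n ε δ a m) := by
  unfold perturb
  split_ifs
  · exact measurable_inl.comp (by fun_prop)
  · exact measurable_const

/-- Conditioning on the Laplace noise: it enters only through a natural number, so measurability for
each fixed count is enough. -/
lemma noiseLaw_release (ε δ : ℝ) (S : Fin n → P.X × Y) {A : Set (E ⊕ Unit)}
    (hA : MeasurableSet A) : noiseLaw d {ω | P.release θ ε δ S ω ∈ A} =
      ∫⁻ w, stdGaussian E {g | P.perturb n ε δ (θ S)
        (privCount ε δ (P.stepCount θ S + (1 / ε) * w)) g ∈ A} ∂laplaceOne := by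
  have h1 : Measurable fun p : ℕ × E => P.perturb n ε δ (θ S) p.1 p.2 :=
    measurable_from_prod_countable_right fun m => P.measurable_perturb n ε δ (θ S) m
  have h2 : Measurable fun ω : ℝ × E =>
      (privCount ε δ (P.stepCount θ S + (1 / ε) * ω.1), ω.2) :=
    ((measurable_privCount ε δ).comp (by fun_prop)).prodMk measurable_snd
  exact Measure.prod_apply ((h1.comp h2) hA)

variable {P}

/-- With the count held equal for both samples, the choice of `⊥` and the noise scale coincide, and
only the center differs. -/
lemma perturb_private (hα : 0 ≤ α) (hρ₀ : 0 < ρ) (hρ₁ : ρ < 1) (hd : 0 < d) (hn : 0 < n)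
    (hθ : P.IsEstimator θ) (hS : Neighboring S S') {ε δ : ℝ} (hε : 0 < ε) (hδ : 0 < δ)
    (hδ1 : δ < 1) {m : ℕ} (hm : m = 0 ∨ m < P.stepCount θ S) {A : Set (E ⊕ Unit)}
    (hA : MeasurableSet A) :
    stdGaussian E {g | P.perturb n ε δ (θ S) m g ∈ A} ≤
      ENNReal.ofReal (Real.exp ε) * stdGaussian E {g | P.perturb n ε δ (θ S') m g ∈ A} +
        ENNReal.ofReal δ := by
  unfold perturb
  split_ifs with h
  · exact stdGaussian_mechanism hε hδ hδ1
      (norm_sub_le_paramChange_lamBound hα hρ₀ hρ₁ hd hn hθ hS hm h) (measurable_inl hA)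
  · have h1 : 1 ≤ ENNReal.ofReal (Real.exp ε) := by
      rw [ENNReal.one_le_ofReal]; exact Real.one_le_exp hε.le
    exact le_add_right (le_mul_of_one_le_left' h1)

/-- The release is `(2 ε, 2 δ)`-differentially private. -/
theorem isDP_release (hα : 0 ≤ α) (hρ₀ : 0 < ρ) (hρ₁ : ρ < 1) (hd : 0 < d) (hn : 0 < n)
    (hθ : P.IsEstimator θ) {ε δ : ℝ} (hε : 0 < ε) (hδ : 0 < δ) (hδ1 : δ < 1) :
    IsDP (noiseLaw d) (P.release θ ε δ) (2 * ε) (2 * δ) := by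
  intro S S' hS A hA
  -- For `2 δ ≥ 1` the claim is trivial; otherwise `k ≥ 0`, as the Laplace tail formula requires.
  rcases le_total 1 (2 * δ) with h2 | h2
  · exact prob_le_one.trans ((ENNReal.one_le_ofReal.2 h2).trans le_add_self)
  set k := Real.log (1 / (2 * δ)) with hk
  have hk0 : 0 ≤ k := Real.log_nonneg (by rw [le_div_iff₀ (by positivity)]; linarith)
  set Γ : (Fin n → P.X × Y) → ℝ → ℝ≥0∞ := fun S a =>
    stdGaussian E {g | P.perturb n ε δ (θ S) (privCount ε δ a) g ∈ A} with hΓ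
  have hΓm : ∀ S, Measurable (Γ S) := fun S =>
    (measurable_of_countable fun m : ℕ =>
      stdGaussian E {g | P.perturb n ε δ (θ S) m g ∈ A}).comp (measurable_privCount ε δ)
  rw [noiseLaw_release P ε δ S hA, noiseLaw_release P ε δ S' hA]
  change ∫⁻ w, Γ S (P.stepCount θ S + (1 / ε) * w) ∂laplaceOne ≤
    _ * ∫⁻ w, Γ S' (P.stepCount θ S' + (1 / ε) * w) ∂laplaceOne + _
  -- Only the center changes here: both sides use the count of `S`. The indicator pays for
  -- overshooting, which costs `exp (-k) / 2 = δ` after integration.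
  have hpt : ∀ w, Γ S (P.stepCount θ S + (1 / ε) * w) ≤
      ENNReal.ofReal (Real.exp ε) * Γ S' (P.stepCount θ S + (1 / ε) * w) + ENNReal.ofReal δ +
        (Set.Ici k).indicator 1 w := fun w => by
    rcases lt_or_ge w k with hw | hw
    · exact le_add_right (perturb_private hα hρ₀ hρ₁ hd hn hθ hS hε hδ hδ1
        (privCount_lt hε hw _) hA)
    · rw [Set.indicator_of_mem (Set.mem_Ici.2 hw)]
      exact le_add_left prob_le_one
  -- Translating the Laplace noise by `c` turns the count of `S'` into that of `S`; sensitivity one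
  -- gives `|c| ≤ ε`.
  set c := ε * ((P.stepCount θ S : ℝ) - P.stepCount θ S') with hc
  have hcε : |c| ≤ ε := by
    rw [hc, abs_mul, abs_of_pos hε]
    exact mul_le_of_le_one_right hε.le (abs_stepCount_sub_le hα hρ₀ hρ₁ hd hn hθ hS)
  have hshift : ∫⁻ w, Γ S' (P.stepCount θ S + (1 / ε) * w) ∂laplaceOne ≤
      ENNReal.ofReal (Real.exp ε) *
        ∫⁻ w, Γ S' (P.stepCount θ S' + (1 / ε) * w) ∂laplaceOne := by
    have h3 := lintegral_laplaceOne_add_le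
      (f := fun w => Γ S' (P.stepCount θ S' + (1 / ε) * w))
      ((hΓm S').comp (by fun_prop)) c
    have e : ∀ w, (P.stepCount θ S' + (1 / ε) * (w + c) : ℝ) =
        P.stepCount θ S + (1 / ε) * w := fun w => by rw [hc]; field_simp; ring
    simp only [e] at h3
    refine h3.trans ?_
    gcongr
  have hmeas : Measurable fun w : ℝ => Γ S' (P.stepCount θ S + (1 / ε) * w) :=
    (hΓm S').comp (by fun_prop)
  calc ∫⁻ w, Γ S (P.stepCount θ S + (1 / ε) * w) ∂laplaceOne
      ≤ ∫⁻ w, (ENNReal.ofReal (Real.exp ε) * Γ S' (P.stepCount θ S + (1 / ε) * w) +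
          ENNReal.ofReal δ + (Set.Ici k).indicator 1 w) ∂laplaceOne := lintegral_mono hpt
    _ = ENNReal.ofReal (Real.exp ε) * ∫⁻ w, Γ S' (P.stepCount θ S + (1 / ε) * w) ∂laplaceOne +
          ENNReal.ofReal δ + ENNReal.ofReal δ := by
        rw [lintegral_add_right _ (measurable_one.indicator measurableSet_Ici),
          lintegral_add_right _ measurable_const, lintegral_const_mul _ hmeas, lintegral_const,
          measure_univ, mul_one, lintegral_indicator_one measurableSet_Ici,
          laplaceOne_apply_Ici hk0]
        congr 3
        rw [hk, one_div, Real.log_inv, neg_neg, Real.exp_log (by positivity)]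
        ring
    _ ≤ ENNReal.ofReal (Real.exp ε) * (ENNReal.ofReal (Real.exp ε) *
          ∫⁻ w, Γ S' (P.stepCount θ S' + (1 / ε) * w) ∂laplaceOne) +
          ENNReal.ofReal δ + ENNReal.ofReal δ := by gcongr
    _ = _ := by
        rw [← mul_assoc, ← ENNReal.ofReal_mul (Real.exp_pos _).le, ← Real.exp_add, add_assoc,
          ← ENNReal.ofReal_add hδ.le hδ.le, two_mul, two_mul]

/-! ### Accuracy of the release -/

/-- The deterministic part of the accuracy claim, for noise in the typical range. In `C`, the terms
with `ρ` secure `LargeEnough` and `16 α` secures that `t` is defined, both down to half of `λ_min +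
λ_reg`; `16 α + 4` absorbs the undershoot and `16 (2 + K)` the noise size. -/
lemma exists_release_eq (hα : 0 ≤ α) (hρ₀ : 0 < ρ) (hρ₁ : ρ < 1) (hd : 0 < d) (hn : 0 < n)
    {K C ε δ w b : ℝ} {g : E} (hε : 0 < ε) (hδ : 0 < δ) (hδ1 : δ < 1) (hK : 0 ≤ K)
    (hC : C = 16 * (2 + K) + 16 * α + 4 + 8 * α / (ρ * (1 - ρ)) + 2 / ρ)
    (hKε : ε ≤ K * Real.log (1 / δ)) (hμ : 0 < P.lamMin θ S + P.lamReg)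
    (hlarge : C * (1 / ε * Real.log (1 / δ) * (P.L₁ / n + P.L₀ * P.radius / n)
      + P.L₀ * P.radius / n + P.L₁ / n) ≤ P.lamMin θ S + P.lamReg)
    (hw : -max (Real.log (1 / (2 * δ))) 0 < w) (hg : ‖g‖ ≤ 2 * b) :
    ∃ v : E, P.release θ ε δ S (w, g) = Sum.inl v ∧
      ‖v - θ S‖ ≤ C * (P.L₀ / (n * (P.lamMin θ S + P.lamReg))) * (1 / ε)
        * Real.sqrt (Real.log (1 / δ)) * b := by
  have hL := P.L₀_nonneg (S ⟨0, hn⟩)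
  have hL1 := P.L₁_nonneg (S ⟨0, hn⟩)
  have hr := P.radius_nonneg
  have hn' : (0 : ℝ) < n := Nat.cast_pos.2 hn
  have hρ' : 0 < 1 - ρ := by linarith
  have hreg := P.lamReg_nonneg
  have hb : 0 ≤ b := by linarith [norm_nonneg g]
  set L := Real.log (1 / δ) with hLdef
  have hL0 : 0 < L := Real.log_pos (by rw [lt_div_iff₀ hδ]; linarith)
  have hkL : Real.log (1 / (2 * δ)) ≤ L := by
    apply Real.log_le_log (by positivity)
    gcongr; linarith
  set k := Real.log (1 / (2 * δ))
  set μ := P.lamMin θ S + P.lamReg with hμdef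
  set a₀ := P.L₀ * P.radius / n with ha₀
  set a₁ := P.L₁ / n with ha₁
  set q := 1 / ε * L with hq
  have ha₀0 : 0 ≤ a₀ := by positivity
  have ha₁0 : 0 ≤ a₁ := by positivity
  have hq0 : 0 ≤ q := by positivity
  have hc1 : 0 ≤ 8 * α / (ρ * (1 - ρ)) := by positivity
  have hc2 : 0 ≤ 2 / ρ := by positivity
  have hs0 : 0 ≤ q * (a₁ + a₀) + a₀ + a₁ := by positivity
  have hfrac : ∀ c, c ≤ C → c * (q * (a₁ + a₀) + a₀ + a₁) ≤ μ := fun c hc =>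
    (mul_le_mul_of_nonneg_right hc hs0).trans hlarge
  have hs1 : a₀ + a₁ ≤ q * (a₁ + a₀) + a₀ + a₁ := by
    have : 0 ≤ q * (a₁ + a₀) := by positivity
    linarith
  have hB : ∀ y, 0 ≤ y → μ / 2 - P.lamReg ≤ y →
      P.LargeEnough n y ∧ P.ParamChangeDefined n (y + P.lamReg) := fun y hy h => by
    have hpos : 0 < y + P.lamReg := by linarith
    refine ⟨?_, hpos, ?_⟩
    · have h1 : P.lamReg ≤ P.lamReg / ρ := by
        rw [le_div_iff₀ hρ₀]; exact mul_le_of_le_one_right hreg hρ₁.le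
      have h2 := hfrac (8 * α / (ρ * (1 - ρ)) + 2 / ρ) (by rw [hC]; linarith)
      have h3 := mul_le_mul_of_nonneg_left hs1
        (show 0 ≤ 8 * α / (ρ * (1 - ρ)) + 2 / ρ by linarith)
      have e1 : 4 * P.L₀ * α * P.radius / (ρ * (1 - ρ) * n) =
          8 * α / (ρ * (1 - ρ)) * a₀ / 2 := by rw [ha₀]; field_simp; ring
      have e2 : P.L₁ / (ρ * n) = 2 / ρ * a₁ / 2 := by rw [ha₁]; field_simp
      have h4 := mul_nonneg hc1 ha₁0
      have h5 := mul_nonneg hc2 ha₀0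
      rw [LargeEnough, e1, e2]
      linarith
    · have h2 := hfrac (16 * α) (by rw [hC]; linarith)
      have h3 := mul_le_mul_of_nonneg_left hs1 (show 0 ≤ 16 * α by linarith)
      have h4 := mul_nonneg hα ha₁0
      have e1 : 8 * α * P.radius * P.L₀ / n = 8 * α * a₀ := by rw [ha₀]; ring
      rw [div_le_one (by positivity), ← div_le_iff₀ hn', e1]
      linarith
  have hJb : (1 + 2 * q) * ((4 * α * P.radius * P.L₀ + P.L₁) / n) ≤ μ / 2 := by
    have h2 := hfrac (16 * α + 4) (by rw [hC]; linarith)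
    have e1 : (4 * α * P.radius * P.L₀ + P.L₁) / n = 4 * α * a₀ + a₁ := by rw [ha₀, ha₁]; ring
    rw [e1]
    have t1 := mul_nonneg hα ha₀0
    have t2 := mul_nonneg hα ha₁0
    have t3 := mul_nonneg hq0 t1
    have t4 := mul_nonneg hq0 t2
    have t5 := mul_nonneg hq0 ha₀0
    have t6 := mul_nonneg hq0 ha₁0
    nlinarith
  set m := privCount ε δ (P.stepCount θ S + (1 / ε) * w) with hm
  -- The undershoot: `1` from the floor, one `q` from the deliberate shift and one `q` from the
  -- Laplace noise.
  have hmN : (P.stepCount θ S : ℝ) ≤ m + (1 + 2 * q) := by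
    have h1 := (Nat.lt_floor_add_one
      (max (P.stepCount θ S + (1 / ε) * w - (1 / ε) * k) 0)).le
    have h2 : P.stepCount θ S + (1 / ε) * w - (1 / ε) * k ≤ m + 1 := (le_max_left _ _).trans h1
    have h3 : -(1 / ε * L) ≤ (1 / ε) * w := by
      rw [← mul_neg]
      have : max k 0 ≤ L := max_le hkL hL0.le
      gcongr; linarith
    have h4 : (1 / ε) * k ≤ 1 / ε * L := by gcongr
    linarith
  have hhalf : μ / 2 ≤ P.lamBound n m + P.lamReg :=
    half_le_lamBound_add hα hρ₀ hρ₁ hd hn (by positivity) hmN hB hJb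
  have hdef := (hB (P.lamBound n m) (lamBound_nonneg m) (by linarith)).2
  refine ⟨_, by rw [release_eq, perturb, if_pos hdef], ?_⟩
  have ht : P.paramChange n (P.lamBound n m + P.lamReg) ≤ 8 * P.L₀ / (n * μ) := by
    refine (paramChange_le hα hn hL hdef).trans ?_
    calc 4 * P.L₀ / ((P.lamBound n m + P.lamReg) * n) ≤ 4 * P.L₀ / (μ / 2 * n) := by gcongr
      _ = _ := by field_simp; ring
  have ht0 := paramChange_nonneg (n := n) hα hL hdef.1
  have hσ := sqrt_privVariance_le hε hδ hδ1 hK hKε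
  rw [add_sub_cancel_left, norm_smul, Real.norm_of_nonneg (mul_nonneg (Real.sqrt_nonneg _) ht0)]
  calc Real.sqrt (privVariance ε δ) * P.paramChange n (P.lamBound n m + P.lamReg) * ‖g‖
      ≤ ((2 + K) * Real.sqrt L / ε) * (8 * P.L₀ / (n * μ)) * (2 * b) := by gcongr
    _ = (16 * (2 + K)) * (P.L₀ / (n * μ)) * (1 / ε) * Real.sqrt L * b := by ring
    _ ≤ C * (P.L₀ / (n * μ)) * (1 / ε) * Real.sqrt L * b := by
        gcongr
        rw [hC]; linarith

end GLM

/-- The maximum with `0` matters for `δ > 1 / 2`, when the logarithm is negative; the tail is then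
`1 / 2 ≤ δ`. -/
lemma laplaceOne_apply_Iic_neg_le {δ : ℝ} (hδ : 0 < δ) :
    laplaceOne (Set.Iic (-max (Real.log (1 / (2 * δ))) 0)) ≤ ENNReal.ofReal δ := by
  rw [laplaceOne_apply_Iic (neg_nonpos.2 (le_max_right _ _))]
  apply ENNReal.ofReal_le_ofReal
  have h1 : Real.exp (-max (Real.log (1 / (2 * δ))) 0) ≤ 2 * δ := by
    rw [← Real.le_log_iff_exp_le (by positivity), neg_le, ← Real.log_inv, ← one_div]
    exact le_max_left _ _
  linarith

/-- With probability at least `1 - δ - γ`, neither the Laplace nor the Gaussian noise is large. -/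
lemma noiseLaw_le (d : ℕ) {δ γ : ℝ} (hδ : 0 < δ) (hγ : 0 < γ) (hγ1 : γ < 1)
    {T : Set (ℝ × EuclideanSpace ℝ (Fin d))}
    (hT : ∀ w g, -max (Real.log (1 / (2 * δ))) 0 < w →
      ‖g‖ ≤ 2 * (Real.sqrt d + Real.sqrt (Real.log (1 / γ))) → (w, g) ∈ T) :
    ENNReal.ofReal (1 - δ - γ) ≤ noiseLaw d T := by
  set U : Set ℝ := Set.Iic (-max (Real.log (1 / (2 * δ))) 0)
  set V : Set (EuclideanSpace ℝ (Fin d)) :=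
    {g | 2 * (Real.sqrt d + Real.sqrt (Real.log (1 / γ))) < ‖g‖} with hV
  have hVm : MeasurableSet V := measurableSet_lt measurable_const measurable_norm
  set B : Set (ℝ × EuclideanSpace ℝ (Fin d)) := U ×ˢ Set.univ ∪ Set.univ ×ˢ V with hB
  have hBm : MeasurableSet B :=
    (measurableSet_Iic.prod MeasurableSet.univ).union (MeasurableSet.univ.prod hVm)
  have h1 : noiseLaw d B ≤ ENNReal.ofReal (δ + γ) := by
    refine (measure_union_le _ _).trans ?_
    rw [noiseLaw, Measure.prod_prod, Measure.prod_prod, measure_univ, measure_univ, mul_one,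
      one_mul, ENNReal.ofReal_add hδ.le hγ.le]
    refine add_le_add (laplaceOne_apply_Iic_neg_le hδ) ?_
    have := stdGaussian_norm_gt_le (E := EuclideanSpace ℝ (Fin d)) hγ hγ1
    rwa [finrank_euclideanSpace_fin] at this
  calc ENNReal.ofReal (1 - δ - γ) = 1 - ENNReal.ofReal (δ + γ) := by
        rw [sub_sub, ENNReal.ofReal_sub _ (by positivity), ENNReal.ofReal_one]
    _ ≤ 1 - noiseLaw d B := tsub_le_tsub_left h1 1
    _ = noiseLaw d Bᶜ := (prob_compl_eq_one_sub hBm).symm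
    _ ≤ noiseLaw d T := by
        refine measure_mono fun ω hω => ?_
        simp only [hB, Set.mem_compl_iff, Set.mem_union, Set.mem_prod, Set.mem_univ, and_true,
          true_and, not_or] at hω
        exact hT ω.1 ω.2 (not_le.1 hω.1) (not_lt.1 hω.2)

end PrivateGLM

end

/-! ### Privacy and accuracy together -/

theorem mainTheorem1 {α ρ : ℝ} (hα : 0 ≤ α) (hρ₀ : 0 < ρ) (hρ₁ : ρ < 1) :
    (∀ (d n : ℕ) (Y : Type*) (P : PrivateGLM.GLM α ρ d Y)
        (θ : (Fin n → P.X × Y) → EuclideanSpace ℝ (Fin d)) (ε δ : ℝ),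
        0 < d → 0 < n → P.IsEstimator θ → 0 < ε → 0 < δ → δ < 1 →
        PrivateGLM.IsDP (PrivateGLM.noiseLaw d) (P.release θ ε δ) (2 * ε) (2 * δ)) ∧
    ∀ K : ℝ, ∃ C : ℝ, 0 < C ∧
      ∀ (d n : ℕ) (Y : Type*) (P : PrivateGLM.GLM α ρ d Y)
        (θ : (Fin n → P.X × Y) → EuclideanSpace ℝ (Fin d)) (ε δ γ : ℝ) (S : Fin n → P.X × Y),
        0 < d → 0 < n → P.IsEstimator θ → 0 < ε → 0 < δ → δ < 1 → 0 < γ → γ < 1 →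
        ε ≤ K * Real.log (1 / δ) →
        0 < P.lamMin θ S + P.lamReg →
        C * (1 / ε * Real.log (1 / δ) * (P.L₁ / n + P.L₀ * P.radius / n)
            + P.L₀ * P.radius / n + P.L₁ / n) ≤ P.lamMin θ S + P.lamReg →
        ENNReal.ofReal (1 - δ - γ) ≤
          PrivateGLM.noiseLaw d {ω | ∃ v : EuclideanSpace ℝ (Fin d),
            P.release θ ε δ S ω = Sum.inl v ∧
            ‖v - θ S‖ ≤ C * (P.L₀ / (n * (P.lamMin θ S + P.lamReg))) * (1 / ε)
              * Real.sqrt (Real.log (1 / δ)) * (Real.sqrt d + Real.sqrt (Real.log (1 / γ)))} := by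
  refine ⟨fun d n Y P θ ε δ hd hn hθ hε hδ hδ1 =>
    PrivateGLM.GLM.isDP_release hα hρ₀ hρ₁ hd hn hθ hε hδ hδ1, fun K =>
    ⟨16 * (2 + |K|) + 16 * α + 4 + 8 * α / (ρ * (1 - ρ)) + 2 / ρ, ?_, ?_⟩⟩
  · have : 0 < 1 - ρ := by linarith
    positivity
  intro d n Y P θ ε δ γ S hd hn _ hε hδ hδ1 hγ hγ1 hK hμ hlarge
  -- Passing to `|K|` keeps the constant positive for every real `K`.
  have hK' : ε ≤ |K| * Real.log (1 / δ) := hK.trans <|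
    mul_le_mul_of_nonneg_right (le_abs_self K)
      (Real.log_nonneg (by rw [le_div_iff₀ hδ]; linarith))
  exact PrivateGLM.noiseLaw_le d hδ hγ hγ1 fun w g hw hg =>
    PrivateGLM.GLM.exists_release_eq hα hρ₀ hρ₁ hd hn hε hδ hδ1 (abs_nonneg K) rfl hK' hμ
      hlarge hw hg
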